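/- Let $X$ be a complex Banach space and let $(T(t))_{t\in\mathbb R}$ be a $C_0$-group on $X$ with generator $A:D(A)\to X$, spectrum $\sigma(A)$ and resolvent $R(\lambda,A)=(\lambda-A)^{-1}$ ($\lambda\notin\sigma(A)$). Assume that there are $a>0$ and $\theta>\tfrac12$ such that $$\{t\in\mathbb R: it\in\sigma(A)\}\subset(-a,a)\qquad\text{and}\qquad \sup_{t\in\mathbb R,\ |t|\ge a}|t|^{\theta}\,\|R(it,A)\|<\infty .$$ Let $\phi\in L^\infty(\mathbb R,X)$ satisfy $i\,\mathrm{sp}(\phi)\cap\sigma(A)=\emptyset$, where $$\mathrm{sp}(\phi)=\Big\{\omega\in\mathbb R:\ f\in L^1(\mathbb R,\mathbb C),\ \phi*f=0\ \text{ imply }\ \int_{\mathbb R}f(t)e^{-i\omega t}\,dt=0\Big\}$$ is the Beurling spectrum of $\phi$. A mild solution on $\mathbb R$ of $u'=Au+\phi$ is a continuous $u:\mathbb R\to X$ such that, for every $t\in\mathbb R$, $\int_0^t u(s)\,ds\in D(A)$ and $$u(t)=u(0)+A\int_0^t u(s)\,ds+\int_0^t\phi(s)\,ds .$$ Then for each $x\in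 X$ the equation $u'=Au+\phi$ has a unique mild solution $u$ on $\mathbb R$ with $u(0)=x$. If moreover $\sup_{t\in\mathbb R}\|T(t)\|<\infty$, then all these solutions are bounded and uniformly continuous on $\mathbb R$. -/

import Mathlib

open Filter Topology MeasureTheory

noncomputable section

namespace EvolEq

variable {X : Type*} [NormedAddCommGroup X] [NormedSpace ℂ X]

/-- `T` is a `C₀`-group on `X`: a strongly continuous one-parameter group of bounded linear
operators. -/
structure IsC0Group (T : ℝ → X →L[ℂ] X) : Prop where
  map_zero : T 0 = ContinuousLinearMap.id ℂ X
  map_add : ∀ s t : ℝ, T (s + t) = (T s).comp (T t)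
  continuous_orbit : ∀ x : X, Continuous fun t : ℝ => T t x

/-- `y` is the limit of the difference quotients `(T(h)x - x)/h` as `h` decreases to `0`.
Only the operators `T(h)` with `h > 0` matter. -/
def IsGeneratorValue (T : ℝ → X →L[ℂ] X) (x y : X) : Prop :=
  Tendsto (fun h : ℝ => h⁻¹ • (T h x - x)) (𝓝[>] 0) (𝓝 y)

theorem IsGeneratorValue.add {T : ℝ → X →L[ℂ] X} {x₁ x₂ y₁ y₂ : X}
    (h₁ : IsGeneratorValue T x₁ y₁) (h₂ : IsGeneratorValue T x₂ y₂) :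
    IsGeneratorValue T (x₁ + x₂) (y₁ + y₂) := by
  refine (Tendsto.add h₁ h₂).congr fun h => ?_
  rw [← smul_add, _root_.map_add]
  congr 1
  abel

theorem IsGeneratorValue.smul {T : ℝ → X →L[ℂ] X} {x y : X} (c : ℂ)
    (h₁ : IsGeneratorValue T x y) : IsGeneratorValue T (c • x) (c • y) := by
  refine (Tendsto.const_smul h₁ c).congr fun h => ?_
  rw [_root_.map_smul, ← smul_sub, smul_comm]

theorem isGeneratorValue_zero (T : ℝ → X →L[ℂ] X) : IsGeneratorValue T 0 0 := by
  simp [IsGeneratorValue]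

/-- The (infinitesimal) generator `A` of the semigroup `(T(t))_{t ≥ 0}`, as an unbounded operator:
`D(A)` is the set of `x` for which `lim_{h ↓ 0} (T(h)x - x)/h` exists, and `A x` is this limit. -/
def generator (T : ℝ → X →L[ℂ] X) : X →ₗ.[ℂ] X where
  domain :=
    { carrier := {x | ∃ y, IsGeneratorValue T x y}
      add_mem' := fun ⟨y₁, h₁⟩ ⟨y₂, h₂⟩ => ⟨y₁ + y₂, h₁.add h₂⟩
      zero_mem' := ⟨0, isGeneratorValue_zero T⟩
      smul_mem' := fun c _ ⟨y, h⟩ => ⟨c • y, h.smul c⟩ }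
  toFun :=
    { toFun := fun x => Classical.choose x.2
      map_add' := fun x₁ x₂ => tendsto_nhds_unique (Classical.choose_spec (x₁ + x₂).2)
        ((Classical.choose_spec x₁.2).add (Classical.choose_spec x₂.2))
      map_smul' := fun c x => tendsto_nhds_unique (Classical.choose_spec (c • x).2)
        ((Classical.choose_spec x.2).smul c) }

theorem generator_spec (T : ℝ → X →L[ℂ] X) (x : (generator T).domain) :
    IsGeneratorValue T x (generator T x) :=
  Classical.choose_spec x.2

/-- `R` is a bounded two-sided inverse of `l - A : D(A) → X`. -/
structure IsResolventAt (A : X →ₗ.[ℂ] X) (l : ℂ) (R : X →L[ℂ] X) : Prop where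
  mem_domain : ∀ y : X, R y ∈ A.domain
  right_inv : ∀ y : X, l • R y - A ⟨R y, mem_domain y⟩ = y
  left_inv : ∀ x : A.domain, R (l • (x : X) - A x) = x

/-- The spectrum `σ(A)` of an unbounded operator. -/
def spectrumOf (A : X →ₗ.[ℂ] X) : Set ℂ :=
  {l | ¬ ∃ R : X →L[ℂ] X, IsResolventAt A l R}

open Classical in
/-- The resolvent `R(l, A) = (l - A)⁻¹` for `l ∉ σ(A)` (and, by convention, `0` for `l ∈ σ(A)`). -/
def resolventOf (A : X →ₗ.[ℂ] X) (l : ℂ) : X →L[ℂ] X :=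
  if h : ∃ R : X →L[ℂ] X, IsResolventAt A l R then Classical.choose h else 0

theorem resolventOf_spec (A : X →ₗ.[ℂ] X) {l : ℂ} (h : l ∉ spectrumOf A) :
    IsResolventAt A l (resolventOf A l) := by
  have h' : ∃ R : X →L[ℂ] X, IsResolventAt A l R := not_not.mp h
  rw [resolventOf, dif_pos h']
  exact Classical.choose_spec h'

/-- The Beurling spectrum of a bounded measurable function `φ : ℝ → X`: the set of all real `w` such
that every `f ∈ L¹(ℝ, ℂ)` with `φ * f = 0` satisfies `∫ f(t) exp(-i w t) dt = 0`. -/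
def beurlingSpectrum (φ : ℝ → X) : Set ℝ :=
  {w | ∀ f : ℝ → ℂ, Integrable f → (∀ t : ℝ, ∫ s : ℝ, f s • φ (t - s) = 0) →
    ∫ t : ℝ, f t * Complex.exp (-(Complex.I * w * t)) = 0}

/-- `u` is a mild solution on `ℝ` of `u' = A u + φ` (for locally integrable `φ`): `u` is continuous
and, for every real `t`, `∫₀ᵗ u ∈ D(A)` and `u(t) = u(0) + A ∫₀ᵗ u + ∫₀ᵗ φ`. -/
def IsMildSolution (A : X →ₗ.[ℂ] X) (φ u : ℝ → X) : Prop :=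
  Continuous u ∧ ∀ t : ℝ, ∃ h : (∫ s in (0 : ℝ)..t, u s) ∈ A.domain,
    u t = u 0 + A ⟨∫ s in (0 : ℝ)..t, u s, h⟩ + ∫ s in (0 : ℝ)..t, φ s

/-- `u ∈ BUC(ℝ, X)`: `u` is bounded and uniformly continuous. -/
def IsBUC (u : ℝ → X) : Prop :=
  Bornology.IsBounded (Set.range u) ∧ UniformContinuous u

end EvolEq

end

/-! Existence and uniqueness are variation of constants. The candidate T(t)x + ∫₀ᵗ T(t-s)φ(s) ds is
defined for every bounded measurable φ. A difference w of two solutions with the same initial value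
satisfies y' = Ay for y = ∫₀ᵗ w, so T(-s)y(s) is constant and w vanishes.

For a bounded group the point is to bound the integral term by spectral separation. Two closed sets
of frequencies are attached to T and to φ: the complements Λ and S of the frequencies near which
Schwartz functions annihilate T, respectively φ. A Bernstein-type estimate
(`exists_bernstein_const`) shows that Λ sits inside the imaginary spectrum of A and S inside sp(φ),
up to the factor 2π. Hence Λ and S are disjoint, and Λ is compact.

Choose h whose Fourier transform is 1 near Λ and whose Fourier support keeps a distance from S. Then
∫ h(s)T(-s)x ds = x (`IsC0Group.cv_eq_self`). Choose V with ∫ V = 1 and Fourier support so small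
that V(s)h(s-p) still has no frequency in S. Then ∫ V(s)h(s-p)φ(t-s) ds = 0 for all p, and inserting
h in front of φ(t-s) yields ∫ V(s)T(s)φ(t-s) ds = 0. Integrated in t, this says that the V-average
of ∫ T(t-r)φ(r) dr over the shifted intervals from -s to t-s is zero. Each of these differs from the
integral over [0,t] by at most a constant times |s|, so the latter is bounded by a moment of V
(`IsC0Group.norm_duhamel_le`). The same h makes T Lipschitz in operator norm, whence uniform
continuity. -/

open Filter Topology MeasureTheory
open scoped FourierTransform SchwartzMap ContDiff Manifold

noncomputable section

namespace EvolEq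

universe u

variable {X : Type u} [NormedAddCommGroup X] [NormedSpace ℂ X]

/-! ### Localization of Schwartz functions in frequency -/

/-- The frequencies near which every Schwartz function belongs to `N`. -/
def regularSet (N : AddSubgroup 𝓢(ℝ, ℂ)) : Set ℝ :=
  {w | ∃ ε > 0, ∀ g : 𝓢(ℝ, ℂ), tsupport g ⊆ Metric.ball w ε → g ∈ N}

theorem isOpen_regularSet (N : AddSubgroup 𝓢(ℝ, ℂ)) : IsOpen (regularSet N) := by
  rw [Metric.isOpen_iff]
  rintro w ⟨ε, hε, h⟩
  refine ⟨ε / 2, half_pos hε, fun v hv => ⟨ε / 2, half_pos hε, fun g hg => h g (hg.trans ?_)⟩⟩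
  refine Metric.ball_subset_ball' ?_
  have := Metric.mem_ball.1 hv
  linarith

/-- By compactness finitely many of the balls cover the support. A smooth partition of unity splits
g into finitely many Schwartz functions, each supported in one ball. No closedness of N is needed
because the sum is finite. -/
theorem mem_of_tsupport_subset_regularSet (N : AddSubgroup 𝓢(ℝ, ℂ)) (g : 𝓢(ℝ, ℂ))
    (hc : HasCompactSupport g) (hg : tsupport g ⊆ regularSet N) : g ∈ N := by
  have hg' : ∀ w ∈ tsupport g, ∃ ε > 0, ∀ g : 𝓢(ℝ, ℂ), tsupport g ⊆ Metric.ball w ε → g ∈ N := hg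
  choose! ε hε hN using hg'
  obtain ⟨t, htK, ht⟩ := hc.isCompact.elim_nhds_subcover (fun w => Metric.ball w (ε w))
    fun w hw => Metric.ball_mem_nhds w (hε w hw)
  obtain ⟨f, hf⟩ := SmoothPartitionOfUnity.exists_isSubordinate 𝓘(ℝ, ℝ)
    (isClosed_tsupport g) (fun w : t => Metric.ball (w : ℝ) (ε w)) (fun _ => Metric.isOpen_ball)
    (by simpa [Set.iUnion_subtype] using ht)
  have hfc : ∀ i, HasCompactSupport (f i) := fun i =>
    (isCompact_closedBall (i : ℝ) (ε i)).of_isClosed_subset (isClosed_tsupport _)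
      ((hf i).trans Metric.ball_subset_closedBall)
  have hfc' : ∀ i, HasCompactSupport (fun x => (f i x : ℂ)) := fun i =>
    (hfc i).comp_left (g := ((↑) : ℝ → ℂ)) rfl
  have hft : ∀ i, Function.HasTemperateGrowth (fun x => (f i x : ℂ)) := fun i =>
    ((hfc' i).toSchwartzMap
      (Complex.ofRealCLM.contDiff.comp (f i).contMDiff.contDiff)).hasTemperateGrowth
  have hsum : g = ∑ i : t, SchwartzMap.smulLeftCLM ℂ (fun x => (f i x : ℂ)) g := by
    ext x
    rw [sum_apply]
    simp only [SchwartzMap.smulLeftCLM_apply_apply (hft _), smul_eq_mul]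
    rw [← Finset.sum_mul]
    by_cases hx : x ∈ tsupport g
    · have := f.sum_eq_one hx
      rw [finsum_eq_sum_of_fintype] at this
      rw [← Complex.ofReal_sum, this]
      simp
    · rw [image_eq_zero_of_notMem_tsupport hx, mul_zero]
  rw [hsum]
  refine sum_mem fun i _ => hN _ (htK _ i.2) _ ?_
  refine ((SchwartzMap.tsupport_smulLeftCLM_subset _ _).trans Set.inter_subset_right).trans ?_
  exact (tsupport_comp_subset (g := ((↑) : ℝ → ℂ)) rfl _).trans (hf i)

/-! ### Convolution of scalar kernels with bounded vector-valued functions -/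

/-- The convolution of a scalar function with a vector valued one. -/
def cv (f : ℝ → ℂ) (φ : ℝ → X) (t : ℝ) : X :=
  ∫ s, f s • φ (t - s)

theorem integrable_smul_bdd {f : ℝ → ℂ} (hf : Integrable f) {φ : ℝ → X}
    (hφ : StronglyMeasurable φ) {C : ℝ} (hC : ∀ t, ‖φ t‖ ≤ C) :
    Integrable fun s => f s • φ s :=
  hf.smul_of_top_left (memLp_top_of_bound hφ.aestronglyMeasurable C (.of_forall hC))

theorem integrable_cv {f : ℝ → ℂ} (hf : Integrable f) {φ : ℝ → X}
    (hφ : StronglyMeasurable φ) {C : ℝ} (hC : ∀ t, ‖φ t‖ ≤ C) (t : ℝ) :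
    Integrable fun s => f s • φ (t - s) :=
  integrable_smul_bdd hf (φ := fun s => φ (t - s)) (hφ.comp_measurable (by fun_prop))
    fun s => hC (t - s)

theorem norm_cv_le {f : ℝ → ℂ} (hf : Integrable f) {φ : ℝ → X} {C : ℝ}
    (hC : ∀ t, ‖φ t‖ ≤ C) (t : ℝ) : ‖cv f φ t‖ ≤ (∫ s, ‖f s‖) * C := by
  rw [cv, ← integral_mul_const]
  refine norm_integral_le_of_norm_le (hf.norm.mul_const C) (.of_forall fun s => ?_)
  rw [norm_smul]
  exact mul_le_mul_of_nonneg_left (hC _) (norm_nonneg _)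

theorem stronglyMeasurable_cv {f : ℝ → ℂ} (hf : StronglyMeasurable f) {φ : ℝ → X}
    (hφ : StronglyMeasurable φ) : StronglyMeasurable (cv f φ) := by
  refine StronglyMeasurable.integral_prod_right (f := fun t s => f s • φ (t - s)) ?_
  exact (hf.comp_measurable measurable_snd).smul
    (hφ.comp_measurable (measurable_fst.sub measurable_snd))

theorem cv_eq_swap (f : ℝ → ℂ) (φ : ℝ → X) (t : ℝ) : cv f φ t = ∫ s, f (t - s) • φ s := by
  rw [cv, ← integral_sub_left_eq_self _ _ t]
  simp

theorem cv_comm (f g : ℝ → ℂ) : cv f g = cv g f := by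
  ext t
  rw [cv_eq_swap, cv]
  simp [mul_comm]

theorem cv_assoc [CompleteSpace X] {f g : ℝ → ℂ} (hf : Integrable f) (hg : Integrable g)
    {φ : ℝ → X} (hφ : StronglyMeasurable φ) {C : ℝ} (hC : ∀ t, ‖φ t‖ ≤ C) (t : ℝ) :
    cv (cv f g) φ t = cv f (cv g φ) t := by
  have hint : Integrable (fun p : ℝ × ℝ => (f p.2 * g (p.1 - p.2)) • φ (t - p.1))
      (volume.prod volume) := by
    have h := hf.convolution_integrand (ContinuousLinearMap.mul ℂ ℂ) hg
    refine Integrable.smul_of_top_left h (memLp_top_of_bound ?_ C (.of_forall fun p => hC _))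
    exact (hφ.comp_measurable (measurable_const.sub measurable_fst)).aestronglyMeasurable
  calc cv (cv f g) φ t = ∫ s, ∫ r, (f r * g (s - r)) • φ (t - s) := by
        simp only [cv, smul_eq_mul]
        congr with s
        rw [integral_smul_const]
    _ = ∫ r, ∫ s, (f r * g (s - r)) • φ (t - s) := integral_integral_swap hint
    _ = cv f (cv g φ) t := by
        simp only [cv]
        congr with r
        rw [← integral_smul, ← integral_add_right_eq_self _ r]
        simp [mul_smul, sub_sub, add_comm]

/-! ### Translation estimates, frequency cutoffs and a Bernstein inequality -/

theorem exists_integral_norm_translate_sub_le (V : 𝓢(ℝ, ℂ)) :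
    ∃ C, 0 ≤ C ∧ ∀ u : ℝ, ∫ x, ‖V (x - u) - V x‖ ≤ C * |u| := by
  set K := SchwartzMap.seminorm ℝ 0 1 V + SchwartzMap.seminorm ℝ 2 1 V with hK
  have hK0 : 0 ≤ K := by positivity
  have hV' : ∀ y, ‖deriv V y‖ ≤ K * (1 + y ^ 2)⁻¹ := fun y => by
    have h0 := SchwartzMap.le_seminorm' ℝ 0 1 V y
    have h2 := SchwartzMap.le_seminorm' ℝ 2 1 V y
    rw [iteratedDeriv_one] at h0 h2
    rw [sq_abs] at h2
    rw [← div_eq_mul_inv, le_div_iff₀ (by positivity)]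
    linarith
  -- The first term serves |u| ≥ 1, the second |u| ≤ 1. There the mean value inequality applies, and
  -- the 3 comes from 1 + x² ≤ 3(1 + y²) when |y - x| ≤ 1.
  refine ⟨2 * (∫ x, ‖V x‖) + 3 * K * ∫ x : ℝ, (1 + x ^ 2)⁻¹, by positivity, fun u => ?_⟩
  have hI1 : 0 ≤ ∫ x, ‖V x‖ := integral_nonneg fun _ => norm_nonneg _
  have hI2 : 0 ≤ ∫ x : ℝ, (1 + x ^ 2)⁻¹ := integral_nonneg fun _ => by positivity
  rcases le_total |u| 1 with hu | hu
  · have h : ∀ x, ‖V (x - u) - V x‖ ≤ 3 * K * |u| * (1 + x ^ 2)⁻¹ := fun x => by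
      have hb : ∀ y ∈ Metric.closedBall x |u|, ‖deriv V y‖ ≤ 3 * K * (1 + x ^ 2)⁻¹ := by
        intro y hy
        rw [Metric.mem_closedBall, Real.dist_eq] at hy
        refine (hV' y).trans ?_
        rw [mul_comm 3 K, mul_assoc]
        refine mul_le_mul_of_nonneg_left ?_ hK0
        rw [← div_eq_mul_inv, inv_eq_one_div, div_le_div_iff₀ (by positivity) (by positivity)]
        have h1 : (y - x) ^ 2 ≤ 1 := by
          rw [← sq_abs]; exact pow_le_one₀ (abs_nonneg _) (hy.trans hu)
        nlinarith [sq_nonneg (y + (y - x))]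
      have := Convex.norm_image_sub_le_of_norm_deriv_le (f := V) (x := x) (y := x - u)
        (fun y _ => V.differentiableAt) hb (convex_closedBall x |u|)
        (Metric.mem_closedBall_self (abs_nonneg u)) (by simp)
      refine this.trans (le_of_eq ?_)
      simp
      ring
    refine (integral_mono_of_nonneg (.of_forall fun _ => norm_nonneg _)
      (integrable_inv_one_add_sq.const_mul _) (.of_forall h)).trans ?_
    rw [integral_const_mul]
    nlinarith [mul_nonneg hI1 (abs_nonneg u)]
  · calc ∫ x, ‖V (x - u) - V x‖ ≤ ∫ x, (‖V (x - u)‖ + ‖V x‖) :=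
          integral_mono_of_nonneg (.of_forall fun _ => norm_nonneg _)
            ((V.integrable.comp_sub_right u).norm.add V.integrable.norm)
            (.of_forall fun x => norm_sub_le _ _)
      _ = 2 * ∫ x, ‖V x‖ := by
          rw [integral_add (V.integrable.comp_sub_right u).norm V.integrable.norm,
            integral_sub_right_eq_self (fun x => ‖V x‖)]
          ring
      _ ≤ _ := by nlinarith [mul_nonneg hI1 (sub_nonneg.2 hu), mul_nonneg hK0 hI2,
                    mul_nonneg (mul_nonneg hK0 hI2) (abs_nonneg u)]

theorem cv_fourierInv_eq_self {G h : 𝓢(ℝ, ℂ)} (hG : ∀ ξ, G ξ * 𝓕 h ξ = 𝓕 h ξ) :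
    cv (𝓕⁻ G : 𝓢(ℝ, ℂ)) h = h := by
  have h1 : SchwartzMap.convolution (ContinuousLinearMap.mul ℂ ℂ) (𝓕⁻ G) h = h := by
    refine (FourierTransform.fourierEquiv ℂ 𝓢(ℝ, ℂ)).injective ?_
    ext ξ
    simp [SchwartzMap.fourier_convolution, hG]
  ext t
  have h2 := SchwartzMap.convolution_apply (ContinuousLinearMap.mul ℂ ℂ) (𝓕⁻ G) h t
  rw [h1] at h2
  rw [h2]
  rfl

/-- A fixed smooth function equal to `1` near `[-1, 1]`. -/
def cutoffBump : ContDiffBump (0 : ℝ) := ⟨1, 2, one_pos, one_lt_two⟩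

theorem hasCompactSupport_cutoff (w : ℝ) {ε : ℝ} (hε : 0 < ε) :
    HasCompactSupport fun ξ : ℝ => (cutoffBump ((ξ - w) / ε) : ℂ) := by
  have h : HasCompactSupport fun ξ : ℝ => cutoffBump ((ξ - w) / ε) := by
    refine HasCompactSupport.of_support_subset_isCompact (isCompact_closedBall w (2 * ε)) ?_
    intro ξ hξ
    have : (ξ - w) / ε ∈ Function.support cutoffBump := hξ
    rw [cutoffBump.support_eq] at this
    simp only [cutoffBump, Metric.mem_ball, dist_zero_right, Real.norm_eq_abs, abs_div,
      abs_of_pos hε, div_lt_iff₀ hε] at this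
    rw [Metric.mem_closedBall, Real.dist_eq]
    exact this.le
  exact h.comp_left (g := ((↑) : ℝ → ℂ)) rfl

/-- A cutoff function equal to `1` on the ball of radius `ε` around `w`. -/
def cutoff (w : ℝ) {ε : ℝ} (hε : 0 < ε) : 𝓢(ℝ, ℂ) :=
  (hasCompactSupport_cutoff w hε).toSchwartzMap (by
    refine Complex.ofRealCLM.contDiff.comp (cutoffBump.contDiff.comp ?_)
    fun_prop)

theorem cutoff_apply (w : ℝ) {ε : ℝ} (hε : 0 < ε) (ξ : ℝ) :
    cutoff w hε ξ = (cutoffBump ((ξ - w) / ε) : ℂ) := rfl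

theorem cutoff_eq_one {w ε : ℝ} (hε : 0 < ε) {ξ : ℝ} (hξ : |ξ - w| ≤ ε) : cutoff w hε ξ = 1 := by
  rw [cutoff_apply, cutoffBump.one_of_mem_closedBall, Complex.ofReal_one]
  simp only [cutoffBump, Metric.mem_closedBall, dist_zero_right, Real.norm_eq_abs, abs_div,
      abs_of_pos hε, div_le_iff₀ hε, one_mul]
  exact hξ

theorem cutoff_eq_zero {w ε : ℝ} (hε : 0 < ε) {ξ : ℝ} (hξ : 2 * ε ≤ |ξ - w|) :
    cutoff w hε ξ = 0 := by
  rw [cutoff_apply, cutoffBump.zero_of_le_dist, Complex.ofReal_zero]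
  simp only [cutoffBump, dist_zero_right, Real.norm_eq_abs, abs_div,
      abs_of_pos hε, le_div_iff₀ hε]
  exact hξ

/-- The inverse Fourier transform of `cutoff 0 1`. -/
def kern : 𝓢(ℝ, ℂ) := 𝓕⁻ (cutoff 0 one_pos)

theorem fourierInv_cutoff_apply (w : ℝ) {ε : ℝ} (hε : 0 < ε) (r : ℝ) :
    (𝓕⁻ (cutoff w hε) : 𝓢(ℝ, ℂ)) r =
      ε * Complex.exp (2 * Real.pi * Complex.I * w * r) * kern (ε * r) := by
  rw [kern, SchwartzMap.fourierInv_coe, SchwartzMap.fourierInv_coe, Real.fourierInv_eq',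
    Real.fourierInv_eq', ← integral_const_mul]
  rw [← integral_sub_right_eq_self _ (-w)]
  have := Measure.integral_comp_mul_left (fun v : ℝ => Complex.exp (↑(2 * Real.pi * inner ℝ (v - -w) r) * Complex.I) • cutoff w hε (v - -w)) ε
  rw [abs_of_pos (inv_pos.2 hε), eq_inv_smul_iff₀ hε.ne'] at this
  rw [← this, ← integral_smul]
  congr with v
  simp only [cutoff_apply, smul_eq_mul, Complex.real_smul, RCLike.inner_apply, conj_trivial]
  have e1 : (ε * v - -w - w) / ε = (v - 0) / 1 := by field_simp; ring
  rw [e1, mul_assoc, mul_assoc, ← mul_assoc (Complex.exp _) (Complex.exp _), ← Complex.exp_add]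
  congr 3
  push_cast
  ring

variable [CompleteSpace X]

/-- With V the inverse transform of a cutoff equal to 1 on the ball, h = V * h, so the translation
can be moved onto V. Up to a unimodular factor V is a dilate of `kern`, hence C depends on `kern`
alone. The bound involves B rather than K, so that it can be absorbed when B is the supremum of ‖h *
φ‖. -/
theorem exists_bernstein_const : ∃ C, 0 ≤ C ∧ ∀ (w ε : ℝ), 0 < ε → ∀ h : 𝓢(ℝ, ℂ),
    tsupport (𝓕 h : 𝓢(ℝ, ℂ)) ⊆ Metric.ball w ε →
    ∀ {Y : Type u} [NormedAddCommGroup Y] [NormedSpace ℂ Y] [CompleteSpace Y]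
    (φ : ℝ → Y), StronglyMeasurable φ → ∀ K, (∀ t, ‖φ t‖ ≤ K) →
    ∀ B, (∀ t, ‖cv h φ t‖ ≤ B) → ∀ s t : ℝ,
    ‖cv h φ (t - s) - Complex.exp (-(2 * Real.pi * Complex.I * w * s)) • cv h φ t‖
      ≤ C * (ε * |s|) * B := by
  obtain ⟨C, hC0, hC⟩ := exists_integral_norm_translate_sub_le kern
  refine ⟨C, hC0, fun w ε hε h hh Y _ _ _ φ hφ K hK B hB s t => ?_⟩
  set V : 𝓢(ℝ, ℂ) := 𝓕⁻ (cutoff w hε) with hV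
  have hVh : cv V h = h := cv_fourierInv_eq_self fun ξ => by
    by_cases hξ : ξ ∈ tsupport (𝓕 h : 𝓢(ℝ, ℂ))
    · have := hh hξ
      rw [Metric.mem_ball, Real.dist_eq] at this
      rw [cutoff_eq_one hε this.le, one_mul]
    · rw [image_eq_zero_of_notMem_tsupport hξ, mul_zero]
  have hψ : ∀ t, cv h φ t = cv V (cv h φ) t := fun t => by
    rw [← cv_assoc V.integrable h.integrable hφ hK, hVh]
  have hψm : StronglyMeasurable (cv h φ) :=
    stronglyMeasurable_cv h.continuous.stronglyMeasurable hφ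
  set c := Complex.exp (-(2 * Real.pi * Complex.I * w * s)) with hc
  have hD : cv h φ (t - s) - c • cv h φ t = cv (fun r => V (r - s) - c * V r) (cv h φ) t := by
    have h1 : cv V (cv h φ) (t - s) = ∫ r, V (r - s) • cv h φ (t - r) := by
      rw [cv, ← integral_sub_right_eq_self _ s]
      simp
    rw [hψ (t - s), hψ t, h1, cv, cv, ← integral_smul, ← integral_sub]
    · simp only [sub_smul, mul_smul]
    · exact integrable_cv (V.integrable.comp_sub_right s) hψm hB t
    · exact (integrable_cv V.integrable hψm hB t).smul c
  have hDn : ∀ r, ‖V (r - s) - c * V r‖ = ε * ‖kern (ε * r - ε * s) - kern (ε * r)‖ := fun r => by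
    rw [hV, fourierInv_cutoff_apply, fourierInv_cutoff_apply]
    have e : ε * Complex.exp (2 * Real.pi * Complex.I * w * ↑(r - s)) * kern (ε * (r - s)) -
        c * (ε * Complex.exp (2 * Real.pi * Complex.I * w * r) * kern (ε * r)) =
        ε * Complex.exp (↑(2 * Real.pi * w * (r - s)) * Complex.I) *
          (kern (ε * r - ε * s) - kern (ε * r)) := by
      have e1 : Complex.exp (2 * Real.pi * Complex.I * w * ↑(r - s)) =
          Complex.exp (↑(2 * Real.pi * w * (r - s)) * Complex.I) := by
        congr 1; push_cast; ring
      have e2 : c * Complex.exp (2 * Real.pi * Complex.I * w * r) =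
          Complex.exp (↑(2 * Real.pi * w * (r - s)) * Complex.I) := by
        rw [hc, ← Complex.exp_add]; congr 1; push_cast; ring
      rw [e1, mul_sub ε r s]
      linear_combination (- ε * kern (ε * r)) * e2
    rw [e, norm_mul, norm_mul, Complex.norm_exp_ofReal_mul_I, mul_one, Complex.norm_real,
      Real.norm_of_nonneg hε.le]
  rw [hD]
  refine (norm_cv_le ((V.integrable.comp_sub_right s).sub (V.integrable.const_mul c)) hB t).trans ?_
  refine mul_le_mul_of_nonneg_right ?_ ((norm_nonneg _).trans (hB 0))
  simp only [Pi.sub_apply, hDn]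
  rw [integral_const_mul, Measure.integral_comp_mul_left
    (fun x => ‖kern (x - ε * s) - kern x‖) ε, abs_of_pos (inv_pos.2 hε), smul_eq_mul,
    mul_inv_cancel_left₀ hε.ne']
  simpa [abs_mul, abs_of_pos hε] using hC (ε * s)

/-! ### Frequencies outside the Beurling spectrum -/

/-- The Schwartz functions whose inverse Fourier transform is annihilated by convolution
with `φ`. -/
def annihilator (φ : ℝ → X) (hφ : StronglyMeasurable φ) (K : ℝ) (hK : ∀ t, ‖φ t‖ ≤ K) :
    AddSubgroup 𝓢(ℝ, ℂ) where
  carrier := {g | ∀ t, cv (𝓕⁻ g : 𝓢(ℝ, ℂ)) φ t = 0}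
  zero_mem' := fun t => by simp [cv, FourierTransform.fourierInv_zero]
  add_mem' := fun {a b} ha hb t => by
    have := ha t
    have := hb t
    simp only [cv, FourierTransform.fourierInv_add, add_apply, add_smul] at *
    rw [integral_add (integrable_cv (SchwartzMap.integrable _) hφ hK t)
      (integrable_cv (SchwartzMap.integrable _) hφ hK t)]
    simp [*]
  neg_mem' := fun {a} ha t => by
    have := ha t
    simp only [cv, FourierTransform.fourierInv_neg, neg_apply, neg_smul] at *
    rw [integral_neg, this, neg_zero]

/-- Let f * φ = 0 with nonzero Fourier integral c at 2πw. If h has frequencies near w, then ψ = h *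
φ is almost an exponential, so 0 = f * ψ is almost cψ. The error is a small multiple of sup ‖ψ‖,
which forces ψ = 0. -/
theorem mem_regularSet_annihilator (φ : ℝ → X) (hφ : StronglyMeasurable φ) (K : ℝ)
    (hK : ∀ t, ‖φ t‖ ≤ K) {w : ℝ} (hw : 2 * Real.pi * w ∉ beurlingSpectrum φ) :
    w ∈ regularSet (annihilator φ hφ K hK) := by
  simp only [beurlingSpectrum, Set.mem_ofPred_eq, not_forall] at hw
  obtain ⟨f, hf, hfφ, hc⟩ := hw
  set c := ∫ t : ℝ, f t * Complex.exp (-(Complex.I * ↑(2 * Real.pi * w) * t)) with hcdef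
  obtain ⟨C, hC0, hC⟩ := exists_bernstein_const.{u}
  -- The minimum with 2 supplies the dominating function, since |s||f(s)| need not be integrable.
  have hlim : Tendsto (fun n : ℕ => ∫ s, ‖f s‖ * min 2 (C * ((n + 1 : ℝ)⁻¹ * |s|))) atTop
      (𝓝 (∫ s, ‖f s‖ * 0)) := by
    refine tendsto_integral_of_dominated_convergence (fun s => ‖f s‖ * 2) (fun n => ?_)
      (hf.norm.mul_const 2) (fun n => .of_forall fun s => ?_) (.of_forall fun s => ?_)
    · exact hf.aestronglyMeasurable.norm.mul (by fun_prop)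
    · rw [Real.norm_of_nonneg (by positivity)]
      gcongr
      exact min_le_left _ _
    · refine Tendsto.const_mul _ ?_
      have h1 : Tendsto (fun n : ℕ => ((n : ℝ) + 1)⁻¹) atTop (𝓝 0) := by
        simpa using tendsto_one_div_add_atTop_nhds_zero_nat (𝕜 := ℝ)
      have h2 := (tendsto_const_nhds (x := (2 : ℝ))).min ((h1.mul_const |s|).const_mul C)
      simpa using h2
  simp only [mul_zero, integral_zero] at hlim
  -- The radius is taken so small that the error integral is less than ‖c‖.
  obtain ⟨n, hn⟩ := (hlim.eventually_lt_const (norm_pos_iff.2 hc)).exists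
  set ε : ℝ := (n + 1 : ℝ)⁻¹ with hε
  have hε0 : 0 < ε := by positivity
  refine ⟨ε, hε0, fun g hg => ?_⟩
  set h : 𝓢(ℝ, ℂ) := 𝓕⁻ g with hh
  have hFh : 𝓕 h = g := by simp [hh]
  set ψ := cv h φ with hψdef
  have hψm : StronglyMeasurable ψ := stronglyMeasurable_cv h.continuous.stronglyMeasurable hφ
  have hψK : ∀ t, ‖ψ t‖ ≤ (∫ s, ‖h s‖) * K := fun t => norm_cv_le h.integrable hK t
  have hbdd : BddAbove (Set.range fun t => ‖ψ t‖) := ⟨_, by rintro _ ⟨t, rfl⟩; exact hψK t⟩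
  set B := ⨆ t, ‖ψ t‖ with hB
  have hψB : ∀ t, ‖ψ t‖ ≤ B := fun t => le_ciSup hbdd t
  have hB0 : 0 ≤ B := (norm_nonneg _).trans (hψB 0)
  have hfψ : ∀ t, cv f ψ t = 0 := fun t => by
    have h0 : cv f φ = 0 := funext hfφ
    rw [hψdef, ← cv_assoc hf h.integrable hφ hK, cv_comm, cv_assoc h.integrable hf hφ hK, h0]
    simp [cv]
  have hexp : Integrable fun s : ℝ => f s * Complex.exp (-(Complex.I * ↑(2 * Real.pi * w) * s)) := by
    refine hf.mul_bdd (c := 1) (by fun_prop) (.of_forall fun s => ?_)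
    rw [show -(Complex.I * ↑(2 * Real.pi * w) * s) = ↑(-(2 * Real.pi * w * s)) * Complex.I by
      push_cast; ring, Complex.norm_exp_ofReal_mul_I]
  have hest : ∀ t, ‖c‖ * ‖ψ t‖ ≤ (∫ s, ‖f s‖ * min 2 (C * (ε * |s|))) * B := fun t => by
    have e : c • ψ t = -∫ s, f s • (ψ (t - s) -
        Complex.exp (-(2 * Real.pi * Complex.I * w * s)) • ψ t) := by
      simp only [smul_sub]
      rw [integral_sub (integrable_cv hf hψm hψB t)]
      · have := hfψ t
        rw [cv] at this
        rw [this, zero_sub, neg_neg, hcdef, ← integral_smul_const]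
        congr with s
        rw [mul_smul]
        congr 3
        push_cast
        ring
      · refine (hexp.smul_const (ψ t)).congr (.of_forall fun s => ?_)
        simp only [mul_smul]
        congr 3
        push_cast
        ring
    rw [← norm_smul, e, norm_neg, ← integral_mul_const]
    refine norm_integral_le_of_norm_le ?_ (.of_forall fun s => ?_)
    · refine Integrable.mul_const ?_ _
      refine hf.norm.mul_bdd (c := 2) (by fun_prop) (.of_forall fun s => ?_)
      rw [Real.norm_of_nonneg (by positivity)]
      exact min_le_left _ _
    · rw [norm_smul, mul_assoc ‖f s‖]
      refine mul_le_mul_of_nonneg_left ?_ (norm_nonneg (f s))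
      rw [min_mul_of_nonneg _ _ hB0]
      refine le_min ?_ (hC w ε hε0 h (by rwa [hFh]) φ hφ K hK B hψB s t)
      refine (norm_sub_le _ _).trans ?_
      rw [norm_smul, show -(2 * Real.pi * Complex.I * w * s) =
        ↑(-(2 * Real.pi * w * s)) * Complex.I by push_cast; ring, Complex.norm_exp_ofReal_mul_I]
      linarith [hψB t, hψB (t - s)]
  have hBle : ‖c‖ * B ≤ (∫ s, ‖f s‖ * min 2 (C * (ε * |s|))) * B := by
    rw [hB, Real.mul_iSup_of_nonneg (norm_nonneg _)]
    exact ciSup_le hest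
  have hB1 : B ≤ 0 := by
    by_contra! hpos
    exact absurd (le_of_mul_le_mul_right hBle hpos) (not_le.2 hn)
  intro t
  exact norm_le_zero_iff.1 (show ‖ψ t‖ ≤ 0 from (hψB t).trans hB1)

/-! ### Bounded groups and the imaginary spectrum of the generator -/

variable {T : ℝ → X →L[ℂ] X}

omit [CompleteSpace X] in
theorem IsGeneratorValue.mem_domain {x y : X} (h : IsGeneratorValue T x y) :
    x ∈ (generator T).domain := ⟨y, h⟩

omit [CompleteSpace X] in
theorem IsGeneratorValue.generator_eq {x y : X} (h : IsGeneratorValue T x y)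
    (hx : x ∈ (generator T).domain) : generator T ⟨x, hx⟩ = y :=
  tendsto_nhds_unique (generator_spec T ⟨x, hx⟩) h

namespace IsC0Group

omit [CompleteSpace X] in
theorem apply_add (hT : IsC0Group T) (s t : ℝ) (x : X) : T (s + t) x = T s (T t x) := by
  rw [hT.map_add]; rfl

omit [CompleteSpace X] in
theorem apply_zero (hT : IsC0Group T) (x : X) : T 0 x = x := by
  rw [hT.map_zero]; rfl

theorem exists_bound_of_isCompact (hT : IsC0Group T) {s : Set ℝ} (hs : IsCompact s) :
    ∃ M, ∀ t ∈ s, ‖T t‖ ≤ M := by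
  obtain ⟨M, hM⟩ := banach_steinhaus (g := fun t : s => T t) (𝕜 := ℂ) (𝕜₂ := ℂ) (fun x => by
    obtain ⟨C, hC⟩ := hs.exists_bound_of_continuousOn (hT.continuous_orbit x).continuousOn
    exact ⟨C, fun t => hC t t.2⟩)
  exact ⟨M, fun t ht => hM ⟨t, ht⟩⟩

/-- Uniform boundedness on compact time intervals upgrades strong continuity to joint continuity. -/
theorem continuous_uncurry (hT : IsC0Group T) : Continuous fun p : ℝ × X => T p.1 p.2 := by
  rw [continuous_iff_continuousAt]
  rintro ⟨t₀, x₀⟩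
  obtain ⟨M, hM⟩ := hT.exists_bound_of_isCompact (isCompact_closedBall t₀ 1)
  have h1 : Tendsto (fun p : ℝ × X => M * ‖p.2 - x₀‖) (𝓝 (t₀, x₀)) (𝓝 0) := by
    have : Continuous fun p : ℝ × X => M * ‖p.2 - x₀‖ := by fun_prop
    simpa using this.tendsto (t₀, x₀)
  have h2 : Tendsto (fun p : ℝ × X => T p.1 (p.2 - x₀)) (𝓝 (t₀, x₀)) (𝓝 0) := by
    refine squeeze_zero_norm' ?_ h1
    have : ∀ᶠ p : ℝ × X in 𝓝 (t₀, x₀), p.1 ∈ Metric.closedBall t₀ 1 :=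
      continuous_fst.continuousAt.eventually (Metric.closedBall_mem_nhds t₀ one_pos)
    filter_upwards [this] with p hp
    exact (T p.1).le_of_opNorm_le (hM _ hp) _
  have h3 : Tendsto (fun p : ℝ × X => T p.1 x₀) (𝓝 (t₀, x₀)) (𝓝 (T t₀ x₀)) :=
    ((hT.continuous_orbit x₀).comp continuous_fst).tendsto (t₀, x₀)
  have h4 := h2.add h3
  rw [zero_add] at h4
  exact h4.congr fun p => by simp

omit [CompleteSpace X] in
theorem isGeneratorValue_apply (hT : IsC0Group T) {x y : X} (h : IsGeneratorValue T x y) (s : ℝ) :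
    IsGeneratorValue T (T s x) (T s y) := by
  refine (((T s).continuous.tendsto y).comp h).congr fun r => ?_
  simp only [Function.comp]
  rw [(T s).map_smul_of_tower, map_sub, ← hT.apply_add, ← hT.apply_add, add_comm]

omit [CompleteSpace X] in
theorem resolvent_comm (hT : IsC0Group T) {l : ℂ} {R : X →L[ℂ] X}
    (hR : IsResolventAt (generator T) l R) (s : ℝ) (x : X) : R (T s x) = T s (R x) := by
  have h := hT.isGeneratorValue_apply (generator_spec T ⟨R x, hR.mem_domain x⟩) s
  have h2 := hR.left_inv ⟨T s (R x), h.mem_domain⟩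
  rw [h.generator_eq] at h2
  simp only at h2
  rw [← map_smul, ← map_sub, hR.right_inv] at h2
  exact h2

theorem cv_orbit (hT : IsC0Group T) {M : ℝ} (hM : ∀ t, ‖T t‖ ≤ M) {f : ℝ → ℂ} (hf : Integrable f)
    (x : X) (t : ℝ) : cv f (fun t => T t x) t = T t (cv f (fun t => T t x) 0) := by
  rw [cv, cv, ← ContinuousLinearMap.integral_comp_comm]
  · congr with s
    rw [map_smul, ← hT.apply_add]
    congr 3
    ring
  · exact integrable_cv hf (hT.continuous_orbit x).stronglyMeasurable
      (fun t => (T t).le_of_opNorm_le (hM t) x) 0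

/-- The Schwartz functions whose inverse Fourier transform is annihilated by the functional
calculus of the group. -/
def annihilator (hT : IsC0Group T) (M : ℝ) (hM : ∀ t, ‖T t‖ ≤ M) : AddSubgroup 𝓢(ℝ, ℂ) where
  carrier := {g | ∀ x, cv (𝓕⁻ g : 𝓢(ℝ, ℂ)) (fun t => T t x) 0 = 0}
  zero_mem' := fun t => by simp [cv, FourierTransform.fourierInv_zero]
  add_mem' := fun {a b} ha hb x => by
    have h1 : cv (𝓕⁻ a : 𝓢(ℝ, ℂ)) (fun t => T t x) 0 = 0 := ha x
    have h2 : cv (𝓕⁻ b : 𝓢(ℝ, ℂ)) (fun t => T t x) 0 = 0 := hb x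
    have hint := fun a : 𝓢(ℝ, ℂ) => integrable_cv a.integrable
      (hT.continuous_orbit x).stronglyMeasurable (fun t => (T t).le_of_opNorm_le (hM t) x) 0
    simp only [cv, FourierTransform.fourierInv_add, add_apply, add_smul] at *
    rw [integral_add (hint _) (hint _), h1, h2, add_zero]
  neg_mem' := fun {a} ha x => by
    have := ha x
    simp only [cv, FourierTransform.fourierInv_neg, neg_apply, neg_smul] at *
    rw [integral_neg, this, neg_zero]

/-- Let z be the h-average of the orbit of x, so that y = Rz is that of the orbit of Rx. The
Bernstein estimate for T(t)y, divided by the time step, gives ‖(l - A)y‖ ≤ CεM‖y‖ in the limit. As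
(l - A)y = z, this reads ‖z‖ ≤ CεM‖R‖‖z‖, and z = 0 for small ε. -/
theorem mem_regularSet_annihilator (hT : IsC0Group T) (M : ℝ) (hM : ∀ t, ‖T t‖ ≤ M) {w : ℝ}
    (hw : Complex.I * ↑(2 * Real.pi * w) ∉ spectrumOf (generator T)) :
    w ∈ regularSet (hT.annihilator M hM) := by
  obtain ⟨R, hR⟩ := not_not.1 hw
  set l : ℂ := Complex.I * ↑(2 * Real.pi * w) with hl
  obtain ⟨C, hC0, hC⟩ := exists_bernstein_const.{u}
  have hM0 : 0 ≤ M := (norm_nonneg _).trans (hM 0)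
  set ε : ℝ := (C * M * ‖R‖ + 1)⁻¹ with hε
  have hε0 : 0 < ε := by positivity
  have hε1 : C * M * ‖R‖ * ε < 1 := by
    rw [hε, ← div_eq_mul_inv, div_lt_one (by positivity)]
    linarith
  refine ⟨ε, hε0, fun g hg x => ?_⟩
  set h : 𝓢(ℝ, ℂ) := 𝓕⁻ g with hh
  have hFh : 𝓕 h = g := by simp [hh]
  have hm : ∀ v, StronglyMeasurable fun t => T t v := fun v =>
    (hT.continuous_orbit v).stronglyMeasurable
  have hb : ∀ v t, ‖T t v‖ ≤ M * ‖v‖ := fun v t => (T t).le_of_opNorm_le (hM t) v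
  set z := cv h (fun t => T t x) 0 with hz
  set y := cv h (fun t => T t (R x)) 0 with hy
  have hyz : y = R z := by
    rw [hy, hz, cv, cv, ← ContinuousLinearMap.integral_comp_comm _
      (integrable_cv h.integrable (hm x) (hb x) 0)]
    simp [hT.resolvent_comm hR]
  have hψ : ∀ t, cv h (fun t => T t (R x)) t = T t y := fun t => hT.cv_orbit hM h.integrable _ t
  have hbern : ∀ r > 0, ‖(r : ℝ)⁻¹ • (T r y - y) - (r⁻¹ • (Complex.exp (r * l) - 1)) • y‖ ≤
      C * ε * (M * ‖y‖) := fun r hr => by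
    have h1 := hC w ε hε0 h (by rwa [hFh]) _ (hm (R x)) _ (hb (R x)) (M * ‖y‖)
      (fun t => by rw [hψ]; exact hb y t) (-r) 0
    rw [hψ, hψ, hT.apply_zero, sub_neg_eq_add, zero_add, abs_neg, abs_of_pos hr] at h1
    have e : -(2 * Real.pi * Complex.I * w * ↑(-r)) = r * l := by
      rw [hl]; push_cast; ring
    rw [e] at h1
    rw [smul_assoc, ← smul_sub, norm_smul, norm_inv, Real.norm_of_nonneg hr.le,
      inv_mul_le_iff₀ hr]
    refine le_trans (le_of_eq ?_) (h1.trans (le_of_eq (by ring)))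
    congr 1
    rw [sub_smul, one_smul]
    abel
  have hexp : Tendsto (fun r : ℝ => r⁻¹ • (Complex.exp (r * l) - 1)) (𝓝[>] 0) (𝓝 l) := by
    have h1 : HasDerivAt (fun r : ℝ => Complex.exp (r * l)) l 0 := by
      have h2 : HasDerivAt (fun r : ℝ => (r : ℂ) * l) l 0 := by
        simpa using (Complex.ofRealCLM.hasDerivAt (x := (0 : ℝ))).mul_const l
      simpa using h2.cexp
    have h3 := h1.tendsto_slope_zero_right
    simpa using h3
  have hyd : y ∈ (generator T).domain := hyz ▸ hR.mem_domain z
  have hlim := (generator_spec T ⟨y, hyd⟩).sub (hexp.smul_const y)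
  have hle := le_of_tendsto hlim.norm (eventually_nhdsWithin_of_forall hbern)
  have hz' : l • y - generator T ⟨y, hyd⟩ = z := by
    have := hR.right_inv z
    simp only [← hyz] at this
    exact this
  rw [norm_sub_rev, hz'] at hle
  have hyn : ‖y‖ ≤ ‖R‖ * ‖z‖ := hyz ▸ R.le_opNorm z
  have h5 : ‖z‖ ≤ C * M * ‖R‖ * ε * ‖z‖ := by
    refine hle.trans ?_
    calc C * ε * (M * ‖y‖) ≤ C * ε * (M * (‖R‖ * ‖z‖)) := by gcongr
      _ = _ := by ring
  refine norm_le_zero_iff.1 ?_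
  show ‖z‖ ≤ 0
  by_contra! hpos
  nlinarith

end IsC0Group

/-! ### Kernels reproducing the orbits of a bounded group -/

theorem integral_fourierInv (g : 𝓢(ℝ, ℂ)) : ∫ s, (𝓕⁻ g : 𝓢(ℝ, ℂ)) s = g 0 := by
  have h : 𝓕 (𝓕⁻ g : 𝓢(ℝ, ℂ)) = g := by simp
  conv_rhs => rw [← h]
  rw [SchwartzMap.fourier_coe, Real.fourier_eq']
  simp

theorem integral_fourierInv_cutoff_zero {ε : ℝ} (hε : 0 < ε) :
    ∫ s, (𝓕⁻ (cutoff 0 hε) : 𝓢(ℝ, ℂ)) s = 1 := by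
  rw [integral_fourierInv, cutoff_eq_one hε (by simpa using hε.le)]

theorem fourierInv_compSubConst_apply (h : 𝓢(ℝ, ℂ)) (η r : ℝ) :
    (𝓕⁻ ((𝓕 h).compSubConstCLM ℂ η) : 𝓢(ℝ, ℂ)) r =
      Complex.exp (2 * Real.pi * Complex.I * r * η) * h r := by
  have e : h = 𝓕⁻ (𝓕 h) := by simp
  conv_rhs => rw [e]
  rw [SchwartzMap.fourierInv_coe, SchwartzMap.fourierInv_coe, Real.fourierInv_eq',
    Real.fourierInv_eq', ← integral_const_mul, ← integral_add_right_eq_self _ η]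
  congr with ξ
  simp only [SchwartzMap.compSubConstCLM_apply, smul_eq_mul, RCLike.inner_apply, conj_trivial]
  rw [add_sub_cancel_right, ← mul_assoc (Complex.exp _) (Complex.exp _), ← Complex.exp_add]
  congr 2
  push_cast
  ring

namespace IsC0Group

omit [CompleteSpace X] in
theorem norm_orbit_le {M : ℝ} (hM : ∀ t, ‖T t‖ ≤ M) (x : X) (t : ℝ) : ‖T t x‖ ≤ M * ‖x‖ :=
  (T t).le_of_opNorm_le (hM t) x

omit [CompleteSpace X] in
theorem stronglyMeasurable_orbit (hT : IsC0Group T) (x : X) :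
    StronglyMeasurable fun t => T t x := (hT.continuous_orbit x).stronglyMeasurable

/-- The kernels are the dilates (n+1) `kern`((n+1)s) of a function of integral 1, hence an
approximate identity. -/
theorem tendsto_cv_cutoff (hT : IsC0Group T) {M : ℝ} (hM : ∀ t, ‖T t‖ ≤ M) (x : X) :
    Tendsto (fun n : ℕ => cv (𝓕⁻ (cutoff 0 (n.cast_add_one_pos (α := ℝ))) : 𝓢(ℝ, ℂ))
      (fun t => T t x) 0) atTop (𝓝 x) := by
  have e : ∀ n : ℕ, cv (𝓕⁻ (cutoff 0 (n.cast_add_one_pos (α := ℝ))) : 𝓢(ℝ, ℂ))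
      (fun t => T t x) 0 = ∫ s, kern s • T (-(s * (n + 1 : ℝ)⁻¹)) x := fun n => by
    have hn := n.cast_add_one_pos (α := ℝ)
    have := Measure.integral_comp_mul_left
      (fun s : ℝ => kern s • T (-(s * (n + 1 : ℝ)⁻¹)) x) (n + 1)
    rw [abs_of_pos (inv_pos.2 hn), eq_inv_smul_iff₀ hn.ne'] at this
    rw [← this, ← integral_smul, cv]
    congr with s
    rw [fourierInv_cutoff_apply, mul_comm ((n : ℝ) + 1) s, mul_inv_cancel_right₀ hn.ne']
    simp [mul_smul]
    norm_cast
  simp only [e]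
  have h2 : x = ∫ s, kern s • x := by
    rw [integral_smul_const, kern, integral_fourierInv_cutoff_zero, one_smul]
  conv => rhs; rw [h2]
  refine tendsto_integral_of_dominated_convergence (fun s => ‖kern s‖ * (M * ‖x‖)) (fun n => ?_)
      (kern.integrable.norm.mul_const _) (fun n => .of_forall fun s => ?_)
      (.of_forall fun s => ?_)
  · exact (kern.continuous.smul ((hT.continuous_orbit x).comp (by fun_prop))).aestronglyMeasurable
  · rw [norm_smul]
    exact mul_le_mul_of_nonneg_left (norm_orbit_le hM _ _) (norm_nonneg _)
  · refine Tendsto.const_smul ?_ _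
    have h1 : Tendsto (fun n : ℕ => -(s * ((n : ℝ) + 1)⁻¹)) atTop (𝓝 0) := by
      have := tendsto_one_div_add_atTop_nhds_zero_nat (𝕜 := ℝ)
      simpa using (this.const_mul s).neg
    have h3 := ((hT.continuous_orbit x).tendsto 0).comp h1
    rwa [hT.apply_zero] at h3

/-- For large n the cutoff of radius n + 1 equals 1 on the ball containing Λ, so it differs from 𝓕 h
by a function supported off Λ, which the group annihilates. The averages against h and against the
approximate identity therefore eventually agree. -/
theorem cv_eq_self (hT : IsC0Group T) {M : ℝ} (hM : ∀ t, ‖T t‖ ≤ M) {ρ : ℝ}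
    (hρ : (regularSet (hT.annihilator M hM))ᶜ ⊆ Metric.ball 0 ρ) {h : 𝓢(ℝ, ℂ)}
    (hc : HasCompactSupport (𝓕 h : 𝓢(ℝ, ℂ)))
    (h1 : ∀ᶠ ξ in 𝓝ˢ (regularSet (hT.annihilator M hM))ᶜ, (𝓕 h : 𝓢(ℝ, ℂ)) ξ = 1) (x : X) :
    cv h (fun t => T t x) 0 = x := by
  refine tendsto_nhds_unique (tendsto_const_nhds.congr' ?_) (hT.tendsto_cv_cutoff hM x)
  obtain ⟨N, hN⟩ := exists_nat_ge ρ
  filter_upwards [eventually_ge_atTop N] with n hn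
  have hn' : ρ < n + 1 := by
    have : (N : ℝ) ≤ n := by exact_mod_cast hn
    linarith
  set G := cutoff 0 (n.cast_add_one_pos (α := ℝ)) with hG
  have hmem : G - 𝓕 h ∈ hT.annihilator M hM := by
    refine mem_of_tsupport_subset_regularSet _ _ ?_ ?_
    · exact (hasCompactSupport_cutoff 0 (n.cast_add_one_pos (α := ℝ))).sub hc
    · obtain ⟨U, hU, hΛ, hU1⟩ := eventually_nhdsSet_iff_exists.1 h1
      have hsub : tsupport (G - 𝓕 h : 𝓢(ℝ, ℂ)) ⊆ (U ∩ Metric.ball 0 ρ)ᶜ := by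
        refine closure_minimal (fun ξ hξ hmem => hξ ?_)
          (hU.inter Metric.isOpen_ball).isClosed_compl
        have h2 := hmem.2
        rw [Metric.mem_ball, Real.dist_eq] at h2
        rw [sub_apply, hU1 ξ hmem.1, hG, cutoff_eq_one _ (h2.trans hn').le, sub_self]
      exact hsub.trans (Set.compl_subset_comm.1 (Set.subset_inter hΛ hρ))
  have h3 : cv (𝓕⁻ (G - 𝓕 h) : 𝓢(ℝ, ℂ)) (fun t => T t x) 0 = 0 := hmem x
  have hint := fun a : 𝓢(ℝ, ℂ) => integrable_cv a.integrable
      (hT.stronglyMeasurable_orbit x) (norm_orbit_le hM x) 0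
  rw [sub_eq_add_neg, FourierTransform.fourierInv_add, FourierTransform.fourierInv_neg,
    ← sub_eq_add_neg, FourierTransform.fourierInv_fourier_eq] at h3
  simp only [cv, sub_apply, sub_smul] at h3
  rw [integral_sub (hint _) (hint _), sub_eq_zero] at h3
  exact h3.symm

end IsC0Group

/-! ### Spectral separation of the group and the forcing term -/

/-- A compact set and a disjoint closed set have disjoint thickenings of some common radius δ.
Keeping h within the first leaves room to shift its frequencies by less than δ. -/
theorem exists_fourier_eq_one_nhdsSet {Λ S : Set ℝ} (hΛ : IsCompact Λ) (hS : IsClosed S)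
    (hd : Disjoint Λ S) : ∃ h : 𝓢(ℝ, ℂ), ∃ δ > 0, HasCompactSupport (𝓕 h : 𝓢(ℝ, ℂ)) ∧
      (∀ᶠ ξ in 𝓝ˢ Λ, (𝓕 h : 𝓢(ℝ, ℂ)) ξ = 1) ∧
      ∀ ξ ∈ tsupport (𝓕 h : 𝓢(ℝ, ℂ)), ∀ η, |η| < δ → ξ + η ∉ S := by
  obtain ⟨δ, hδ, hdis⟩ := hd.exists_cthickenings hΛ hS
  obtain ⟨f, hf1, hf0, -⟩ := exists_contMDiffMap_one_nhds_of_subset_interior (n := ⊤) 𝓘(ℝ, ℝ)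
    (t := Metric.cthickening δ Λ) hΛ.isClosed
    ((Metric.self_subset_thickening hδ Λ).trans (interior_maximal
      (Metric.thickening_subset_cthickening δ Λ) Metric.isOpen_thickening))
  have hts : tsupport (fun x => (f x : ℂ)) ⊆ Metric.cthickening δ Λ := by
    refine (tsupport_comp_subset (g := ((↑) : ℝ → ℂ)) rfl _).trans
      (closure_minimal (fun x hx => ?_) Metric.isClosed_cthickening)
    by_contra hx'
    exact hx (hf0 x hx')
  have hc : HasCompactSupport (fun x => (f x : ℂ)) :=
    hΛ.cthickening.of_isClosed_subset (isClosed_tsupport _) hts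
  set g : 𝓢(ℝ, ℂ) := hc.toSchwartzMap
    (Complex.ofRealCLM.contDiff.comp f.contMDiff.contDiff) with hg
  refine ⟨𝓕⁻ g, δ, hδ, ?_, ?_, ?_⟩
  · rw [FourierTransform.fourier_fourierInv_eq]
    exact hc
  · rw [FourierTransform.fourier_fourierInv_eq]
    filter_upwards [hf1] with ξ hξ
    show (f ξ : ℂ) = 1
    rw [hξ, Complex.ofReal_one]
  · rw [FourierTransform.fourier_fourierInv_eq]
    intro ξ hξ η hη hS'
    refine Set.disjoint_left.1 hdis (hts hξ) (Metric.thickening_subset_cthickening δ S ?_)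
    rw [Metric.mem_thickening_iff]
    exact ⟨_, hS', by simpa [Real.dist_eq] using hη⟩

/-- Multiplication by the inverse transform of the cutoff G superposes the modulations of h by η
with weight G(η). Only |η| < δ contributes, since G has radius δ/2 and vanishes beyond δ, and each
such modulation still annihilates φ. -/
theorem integral_mul_translate_smul_eq_zero {φ : ℝ → X} (hφ : StronglyMeasurable φ) {K : ℝ}
    (hK : ∀ t, ‖φ t‖ ≤ K) {h : 𝓢(ℝ, ℂ)} {δ : ℝ} (hδ : 0 < δ)
    (hc : HasCompactSupport (𝓕 h : 𝓢(ℝ, ℂ)))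
    (hh : ∀ ξ ∈ tsupport (𝓕 h : 𝓢(ℝ, ℂ)), ∀ η, |η| < δ →
      ξ + η ∈ regularSet (annihilator φ hφ K hK)) (p t : ℝ) :
    ∫ s, ((𝓕⁻ (cutoff 0 (div_pos hδ two_pos)) : 𝓢(ℝ, ℂ)) s * h (s - p)) • φ (t - s) = 0 := by
  set G := cutoff 0 (div_pos hδ two_pos) with hG
  have hη : ∀ η, |η| < δ → cv (𝓕⁻ ((𝓕 h).compSubConstCLM ℂ η) : 𝓢(ℝ, ℂ)) φ (t - p) = 0 := by
    intro η hη
    have hts : ∀ ξ ∈ tsupport ((𝓕 h).compSubConstCLM ℂ η), ξ - η ∈ tsupport (𝓕 h : 𝓢(ℝ, ℂ)) :=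
      fun ξ hξ => tsupport_comp_subset_preimage (𝓕 h : 𝓢(ℝ, ℂ)) (f := fun ξ => ξ - η)
        (by fun_prop) hξ
    refine mem_of_tsupport_subset_regularSet (annihilator φ hφ K hK) _ ?_ ?_ (t - p)
    · exact hc.comp_homeomorph (Homeomorph.subRight η)
    · intro ξ hξ
      simpa using hh _ (hts ξ hξ) η hη
  have hint : Integrable (fun q : ℝ × ℝ => (Complex.exp (2 * Real.pi * Complex.I * q.1 * q.2) *
      G q.2 * h (q.1 - p)) • φ (t - q.1)) (volume.prod volume) := by
    have h1 : Integrable (fun q : ℝ × ℝ => h (q.1 - p) * G q.2) (volume.prod volume) :=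
      (h.integrable.comp_sub_right p).mul_prod G.integrable
    have h2 : Integrable (fun q : ℝ × ℝ => Complex.exp (2 * Real.pi * Complex.I * q.1 * q.2) *
      G q.2 * h (q.1 - p)) (volume.prod volume) := by
      refine (h1.bdd_mul (c := 1) (f := fun q : ℝ × ℝ =>
        Complex.exp (2 * Real.pi * Complex.I * q.1 * q.2)) ?_ (.of_forall fun q => ?_)).congr
        (.of_forall fun q => by ring)
      · exact Continuous.aestronglyMeasurable (by fun_prop)
      · rw [show 2 * Real.pi * Complex.I * q.1 * q.2 = ↑(2 * Real.pi * q.1 * q.2) * Complex.I by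
          push_cast; ring, Complex.norm_exp_ofReal_mul_I]
    exact Integrable.smul_of_top_left h2 (memLp_top_of_bound
      (hφ.comp_measurable (measurable_const.sub measurable_fst)).aestronglyMeasurable K
      (.of_forall fun _ => hK _))
  calc _ = ∫ s : ℝ, ∫ η : ℝ, (Complex.exp (2 * Real.pi * Complex.I * s * η) *
      G η * h (s - p)) • φ (t - s) := by
        congr with s
        rw [integral_smul_const, integral_mul_const, SchwartzMap.fourierInv_coe,
          Real.fourierInv_eq']
        congr 3 with η
        simp only [smul_eq_mul, RCLike.inner_apply, conj_trivial]
        congr 2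
        push_cast
        ring
    _ = ∫ η : ℝ, ∫ s : ℝ, (Complex.exp (2 * Real.pi * Complex.I * s * η) *
      G η * h (s - p)) • φ (t - s) := integral_integral_swap hint
    _ = ∫ η : ℝ, (0 : X) := by
        congr with η
        by_cases hηδ : |η| < δ
        · have h0 := hη η hηδ
          rw [cv, ← integral_sub_right_eq_self _ p] at h0
          refine Eq.trans ?_ (smul_zero (Complex.exp (2 * Real.pi * Complex.I * p * η) * G η))
          rw [← h0, ← integral_smul]
          congr with s
          rw [fourierInv_compSubConst_apply, smul_smul, sub_sub_sub_cancel_right]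
          congr 1
          have e1 : Complex.exp (2 * Real.pi * Complex.I * s * η) =
              Complex.exp (2 * Real.pi * Complex.I * p * η) *
              Complex.exp (2 * Real.pi * Complex.I * ↑(s - p) * η) := by
            rw [← Complex.exp_add]; congr 1; push_cast; ring
          rw [e1]
          ring
        · rw [hG, cutoff_eq_zero _ (by rw [sub_zero]; linarith)]
          simp
    _ = 0 := integral_zero _ _

/-- Reproducing the vector φ(t-s) by h gives T(s)φ(t-s) = ∫ h(s-p)T(p)φ(t-s) dp. After Fubini, T(p)
leaves the inner integral, which is zero by `hV`. -/
theorem IsC0Group.integral_smul_translate_eq_zero (hT : IsC0Group T) {M : ℝ}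
    (hM : ∀ t, ‖T t‖ ≤ M) {φ : ℝ → X} (hφ : StronglyMeasurable φ) {K : ℝ}
    (hK : ∀ t, ‖φ t‖ ≤ K) {h V : 𝓢(ℝ, ℂ)} (hh : ∀ x, cv h (fun t => T t x) 0 = x)
    (hV : ∀ p t, ∫ s, (V s * h (s - p)) • φ (t - s) = 0) (t : ℝ) :
    ∫ s, V s • T s (φ (t - s)) = 0 := by
  have hM0 : 0 ≤ M := (norm_nonneg _).trans (hM 0)
  have hint : Integrable (fun q : ℝ × ℝ => (V q.2 * h (q.2 - q.1)) • T q.1 (φ (t - q.2)))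
      (volume.prod volume) := by
    have h1 := (V.integrable (μ := volume)).convolution_integrand (ContinuousLinearMap.mul ℂ ℂ)
      (h.integrable (μ := volume)).comp_neg
    refine Integrable.smul_of_top_left (φ := fun q : ℝ × ℝ => V q.2 * h (q.2 - q.1))
      (h1.congr (.of_forall fun q => by simp))
      (memLp_top_of_bound ?_ (M * K) (.of_forall fun q => ?_))
    · refine (hT.continuous_uncurry.comp_stronglyMeasurable (StronglyMeasurable.prodMk
        (f := fun q : ℝ × ℝ => q.1) (g := fun q : ℝ × ℝ => φ (t - q.2)) ?_ ?_)).aestronglyMeasurable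
      · exact measurable_fst.stronglyMeasurable
      · exact hφ.comp_measurable (measurable_const.sub measurable_snd)
    · exact (norm_orbit_le hM _ _).trans (mul_le_mul_of_nonneg_left (hK _) hM0)
  calc _ = ∫ s, ∫ p, (V s * h (s - p)) • T p (φ (t - s)) := by
        congr with s
        conv_lhs => rw [← hh (φ (t - s))]
        rw [← hT.cv_orbit hM h.integrable, cv_eq_swap, ← integral_smul]
        simp only [mul_smul]
    _ = ∫ p, ∫ s, (V s * h (s - p)) • T p (φ (t - s)) := (integral_integral_swap hint).symm
    _ = ∫ p : ℝ, (0 : X) := by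
        congr with p
        rw [← _root_.map_zero (T p), ← hV p t, ← ContinuousLinearMap.integral_comp_comm]
        · simp
        · refine integrable_cv (f := fun s => V s * h (s - p)) ?_ hφ hK t
          refine V.integrable.mul_bdd (c := SchwartzMap.seminorm ℝ 0 0 h) ?_
            (.of_forall fun s => SchwartzMap.norm_le_seminorm ℝ h _)
          exact (h.continuous.comp (by fun_prop)).aestronglyMeasurable
    _ = 0 := integral_zero _ _

/-! ### Variation of constants and mild solutions -/

variable {φ : ℝ → X}

/-- The variation of constants integral. -/
def duhamel (T : ℝ → X →L[ℂ] X) (φ : ℝ → X) (t : ℝ) : X := ∫ s in (0 : ℝ)..t, T (t - s) (φ s)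

omit [NormedSpace ℂ X] [CompleteSpace X] in
theorem intervalIntegrable_of_bound (hφ : StronglyMeasurable φ) {K : ℝ}
    (hK : ∀ t, ‖φ t‖ ≤ K) (a b : ℝ) : IntervalIntegrable φ volume a b :=
  (intervalIntegrable_const (c := K)).mono_fun hφ.aestronglyMeasurable
    (.of_forall fun t => (hK t).trans (le_abs_self K))

/-- `u` satisfies the variation of constants formula between any two times. -/
def IsEvolution (T : ℝ → X →L[ℂ] X) (φ u : ℝ → X) : Prop :=
  ∀ t r, u (t + r) = T r (u t) + ∫ q in (0 : ℝ)..r, T (r - q) (φ (t + q))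

namespace IsC0Group

theorem stronglyMeasurable_apply (hT : IsC0Group T) {Ω : Type*} [MeasurableSpace Ω] {f : Ω → ℝ}
    (hf : Measurable f) {ψ : Ω → X} (hψ : StronglyMeasurable ψ) :
    StronglyMeasurable fun o => T (f o) (ψ o) :=
  hT.continuous_uncurry.comp_stronglyMeasurable (hf.stronglyMeasurable.prodMk hψ)

theorem intervalIntegrable_apply (hT : IsC0Group T) (hφ : StronglyMeasurable φ) {K : ℝ}
    (hK : ∀ t, ‖φ t‖ ≤ K) (t a b : ℝ) :
    IntervalIntegrable (fun s => T (t - s) (φ s)) volume a b := by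
  obtain ⟨M, hM⟩ := hT.exists_bound_of_isCompact
    ((isCompact_uIcc (a := a) (b := b)).image (f := fun s => t - s) (by fun_prop))
  refine (intervalIntegrable_const (c := M * K)).mono_fun
    (hT.stronglyMeasurable_apply (by fun_prop) hφ).aestronglyMeasurable ?_
  refine (ae_restrict_iff' measurableSet_uIoc).2 (.of_forall fun s hs => ?_)
  have h1 := hM (t - s) ⟨s, Set.uIoc_subset_uIcc hs, rfl⟩
  refine le_trans ?_ (le_abs_self _)
  exact ((T (t - s)).le_of_opNorm_le h1 _).trans
    (mul_le_mul_of_nonneg_left (hK s) ((norm_nonneg _).trans h1))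

theorem apply_integral (hT : IsC0Group T) (hφ : StronglyMeasurable φ) {K : ℝ}
    (hK : ∀ t, ‖φ t‖ ≤ K) (r t a b : ℝ) :
    T r (∫ s in a..b, T (t - s) (φ s)) = ∫ s in a..b, T (r + t - s) (φ s) := by
  rw [← ContinuousLinearMap.intervalIntegral_comp_comm _
    (hT.intervalIntegrable_apply hφ hK t a b)]
  congr with s
  rw [← hT.apply_add, add_sub_assoc]

theorem continuous_duhamel (hT : IsC0Group T) (hφ : StronglyMeasurable φ) {K : ℝ}
    (hK : ∀ t, ‖φ t‖ ≤ K) : Continuous (duhamel T φ) := by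
  have h1 : ∀ t, duhamel T φ t = T t (∫ s in (0 : ℝ)..t, T (0 - s) (φ s)) := fun t => by
    rw [hT.apply_integral hφ hK, add_zero, duhamel]
  have h2 : Continuous fun t => ∫ s in (0 : ℝ)..t, T (0 - s) (φ s) :=
    intervalIntegral.continuous_primitive (fun a b => hT.intervalIntegrable_apply hφ hK 0 a b) 0
  rw [funext h1]
  exact hT.continuous_uncurry.comp (continuous_id.prodMk h2)

theorem isEvolution_duhamel (hT : IsC0Group T) (hφ : StronglyMeasurable φ) {K : ℝ}
    (hK : ∀ t, ‖φ t‖ ≤ K) (x : X) : IsEvolution T φ fun t => T t x + duhamel T φ t := by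
  intro t r
  simp only
  rw [_root_.map_add (T r), ← hT.apply_add, duhamel, duhamel, hT.apply_integral hφ hK, add_assoc,
    add_comm r t]
  congr 1
  have h := intervalIntegral.integral_comp_add_left (a := 0) (b := r)
    (fun s => T (t + r - s) (φ s)) t
  simp only [add_sub_add_left_eq_sub, add_zero] at h
  rw [h, intervalIntegral.integral_add_adjacent_intervals
    (hT.intervalIntegrable_apply hφ hK _ _ _) (hT.intervalIntegrable_apply hφ hK _ _ _)]

/-- This produces the forcing term when (T(r) - 1)/r is applied to ∫₀ᵗ u. -/
theorem tendsto_average (hT : IsC0Group T) {p : ℝ → X} (hp : Continuous p) :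
    Tendsto (fun r : ℝ => r⁻¹ • ∫ q in (0 : ℝ)..r, T (r - q) (p q)) (𝓝[>] 0) (𝓝 (p 0)) := by
  have hF : Continuous fun z : ℝ × ℝ => T (z.1 - z.2) (p z.2) :=
    hT.continuous_uncurry.comp ((continuous_fst.sub continuous_snd).prodMk
      (hp.comp continuous_snd))
  rw [Metric.tendsto_nhds]
  intro ε hε
  obtain ⟨δ, hδ, h⟩ := Metric.continuousAt_iff.1 (hF.continuousAt (x := (0, 0))) (ε / 2)
    (half_pos hε)
  simp only [sub_zero, hT.apply_zero] at h
  filter_upwards [Ioo_mem_nhdsGT hδ] with r hr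
  have hr0 : 0 < r := hr.1
  have h1 : ‖∫ q in (0 : ℝ)..r, (T (r - q) (p q) - p 0)‖ ≤ ε / 2 * |r - 0| := by
    refine intervalIntegral.norm_integral_le_of_norm_le_const fun q hq => ?_
    rw [Set.uIoc_of_le hr0.le] at hq
    rw [← dist_eq_norm]
    refine (h (x := (r, q)) ?_).le
    rw [Prod.dist_eq, max_lt_iff]
    simp only [Real.dist_eq, sub_zero]
    exact ⟨by rw [abs_of_pos hr0]; exact hr.2, by rw [abs_of_pos hq.1]; exact hq.2.trans_lt hr.2⟩
  have hi : IntervalIntegrable (fun q => T (r - q) (p q)) volume 0 r :=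
    (hF.comp (continuous_const.prodMk continuous_id)).intervalIntegrable _ _
  rw [intervalIntegral.integral_sub hi intervalIntegrable_const,
    intervalIntegral.integral_const, sub_zero, abs_of_pos hr0] at h1
  have h2 : r⁻¹ • (∫ q in (0 : ℝ)..r, T (r - q) (p q)) - p 0 =
      r⁻¹ • ((∫ q in (0 : ℝ)..r, T (r - q) (p q)) - r • p 0) := by
    rw [smul_sub, inv_smul_smul₀ hr0.ne']
  rw [dist_eq_norm, h2, norm_smul, norm_inv, Real.norm_of_nonneg hr0.le, inv_mul_lt_iff₀ hr0]
  nlinarith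

/-- Since φ is merely measurable, the averaging limit does not apply to it directly. Integrating in
s first replaces it by a continuous function of q. -/
theorem integral_integral_apply (hT : IsC0Group T) (hφ : StronglyMeasurable φ) {K : ℝ}
    (hK : ∀ t, ‖φ t‖ ≤ K) (t r : ℝ) :
    ∫ s in (0 : ℝ)..t, ∫ q in (0 : ℝ)..r, T (r - q) (φ (s + q)) =
      ∫ q in (0 : ℝ)..r, T (r - q) (∫ s in (0 : ℝ)..t, φ (s + q)) := by
  obtain ⟨M, hM⟩ := hT.exists_bound_of_isCompact
    ((isCompact_uIcc (a := 0) (b := r)).image (f := fun s => r - s) (by fun_prop))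
  rw [intervalIntegral_intervalIntegral_swap]
  · congr with q
    rw [ContinuousLinearMap.intervalIntegral_comp_comm]
    exact intervalIntegrable_of_bound (hφ.comp_measurable (by fun_prop)) (fun s => hK (s + q)) _ _
  · refine Measure.integrableOn_of_bounded (M := M * K) ?_ ?_ ?_
    · rw [Measure.volume_eq_prod, Measure.prod_prod]
      exact ENNReal.mul_ne_top (by simp [Set.uIoc]) (by simp [Set.uIoc])
    · exact (hT.stronglyMeasurable_apply (f := fun z : ℝ × ℝ => r - z.2) (by fun_prop)
        (hφ.comp_measurable (measurable_fst.add measurable_snd))).aestronglyMeasurable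
    · refine (ae_restrict_iff' (measurableSet_uIoc.prod measurableSet_uIoc)).2
        (.of_forall fun z hz => ?_)
      have h1 := hM (r - z.2) ⟨z.2, Set.uIoc_subset_uIcc hz.2, rfl⟩
      exact ((T (r - z.2)).le_of_opNorm_le h1 _).trans
        (mul_le_mul_of_nonneg_left (hK _) ((norm_nonneg _).trans h1))

theorem isMildSolution_of_isEvolution (hT : IsC0Group T) (hφ : StronglyMeasurable φ) {K : ℝ}
    (hK : ∀ t, ‖φ t‖ ≤ K) {u : ℝ → X} (hu : Continuous u) (hev : IsEvolution T φ u) :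
    IsMildSolution (generator T) φ u := by
  refine ⟨hu, fun t => ?_⟩
  have hui : ∀ a b, IntervalIntegrable u volume a b := fun a b => hu.intervalIntegrable a b
  have hφi := intervalIntegrable_of_bound hφ hK
  suffices h : IsGeneratorValue T (∫ s in (0 : ℝ)..t, u s)
      (u t - u 0 - ∫ s in (0 : ℝ)..t, φ s) by
    refine ⟨h.mem_domain, ?_⟩
    rw [h.generator_eq]
    abel
  have hU : ∀ a, HasDerivAt (fun r => ∫ s in (0 : ℝ)..r, u s) (u a) a := fun a =>
    hu.integral_hasStrictDerivAt 0 a |>.hasDerivAt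
  have hP : Continuous fun q => ∫ s in (0 : ℝ)..t, φ (s + q) := by
    have h1 : Continuous fun r => ∫ s in (0 : ℝ)..r, φ s :=
      intervalIntegral.continuous_primitive hφi 0
    have h2 : ∀ q, ∫ s in (0 : ℝ)..t, φ (s + q) =
        (∫ s in (0 : ℝ)..(t + q), φ s) - ∫ s in (0 : ℝ)..q, φ s := fun q => by
      rw [intervalIntegral.integral_comp_add_right, zero_add,
        intervalIntegral.integral_interval_sub_left (hφi _ _) (hφi _ _)]
    rw [funext h2]
    exact (h1.comp (by fun_prop)).sub h1
  -- The quotient (T(r) - 1)/r at ∫₀ᵗ u is the slope of the primitive of u at t, minus its slope at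
  -- 0, minus the averaged forcing.
  have hlim := ((hU t).tendsto_slope_zero_right.sub (hU 0).tendsto_slope_zero_right).sub
    (hT.tendsto_average hP)
  simp only [add_zero, zero_add, intervalIntegral.integral_same, sub_zero] at hlim
  refine hlim.congr fun r => ?_
  rw [← smul_sub, ← smul_sub, ← hT.integral_integral_apply hφ hK]
  congr 1
  have e1 : ∀ s, ∫ q in (0 : ℝ)..r, T (r - q) (φ (s + q)) = u (s + r) - T r (u s) := fun s => by
    rw [hev s r, add_sub_cancel_left]
  simp only [e1]
  have i1 : IntervalIntegrable (fun s => u (s + r)) volume 0 t :=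
    (hu.comp (by fun_prop)).intervalIntegrable _ _
  have i2 : IntervalIntegrable (fun s => T r (u s)) volume 0 t :=
    ((T r).continuous.comp hu).intervalIntegrable _ _
  rw [intervalIntegral.integral_sub i1 i2,
    ContinuousLinearMap.intervalIntegral_comp_comm _ (hui _ _),
    intervalIntegral.integral_comp_add_right, zero_add,
    ← intervalIntegral.integral_interval_sub_left (hui 0 (t + r)) (hui 0 r)]
  abel

/-- With y = ∫₀ᵗ w, the right difference quotient of T(-s)y(s) is T(-(s+r)) applied to the
difference of the quotients (y(s+r) - y(s))/r and (T(r)y(s) - y(s))/r. Both tend to w(s), so the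
right derivative is zero. One-sided derivatives suffice for constancy and are all that the generator
provides. -/
theorem eq_zero_of_isMildSolution_zero (hT : IsC0Group T) {w : ℝ → X} (hw : Continuous w)
    (h : ∀ t, IsGeneratorValue T (∫ s in (0 : ℝ)..t, w s) (w t)) : w = 0 := by
  set y : ℝ → X := fun t => ∫ s in (0 : ℝ)..t, w s with hy
  have hyd : ∀ t, HasDerivAt y (w t) t := fun a =>
    hw.integral_hasStrictDerivAt 0 a |>.hasDerivAt
  have hyc : Continuous y := continuous_iff_continuousAt.2 fun t => (hyd t).continuousAt
  set g : ℝ → X := fun s => T (-s) (y s) with hg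
  have hgc : Continuous g := hT.continuous_uncurry.comp (continuous_neg.prodMk hyc)
  have hgd : ∀ s, HasDerivWithinAt g 0 (Set.Ici s) s := fun s => by
    have h1 := (hyd s).tendsto_slope_zero_right.sub (h s)
    rw [sub_self] at h1
    have h2 : Tendsto (fun r : ℝ => -(s + r)) (𝓝[>] 0) (𝓝 (-(s + 0))) :=
      (Continuous.tendsto (by fun_prop) 0).mono_left nhdsWithin_le_nhds
    have h3 := (hT.continuous_uncurry.tendsto (-(s + 0), 0)).comp (h2.prodMk_nhds h1)
    simp only [_root_.map_zero] at h3
    rw [← hasDerivWithinAt_Ioi_iff_Ici, hasDerivWithinAt_iff_tendsto_slope' (by simp)]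
    have h4 : Tendsto (fun r : ℝ => r⁻¹ • (g (s + r) - g s)) (𝓝[>] 0) (𝓝 0) := by
      refine h3.congr fun r => ?_
      simp only [Function.comp, hg]
      rw [← smul_sub, (T _).map_smul_of_tower, sub_sub_sub_cancel_right, map_sub,
        ← hT.apply_add (-(s + r)) r]
      congr 3
      ring_nf
    have h5 : Tendsto (fun z : ℝ => z - s) (𝓝[>] s) (𝓝[>] 0) := by
      refine tendsto_nhdsWithin_iff.2 ⟨?_, ?_⟩
      · have : Tendsto (fun z : ℝ => z - s) (𝓝 s) (𝓝 (s - s)) :=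
          Continuous.tendsto (by fun_prop) s
        rw [sub_self] at this
        exact this.mono_left nhdsWithin_le_nhds
      · filter_upwards [self_mem_nhdsWithin] with z hz
        exact sub_pos.2 (Set.mem_Ioi.1 hz)
    refine (h4.comp h5).congr fun z => ?_
    simp [slope, Function.comp]
  have hconst : ∀ a b, a ≤ b → g b = g a := fun a b hab =>
    constant_of_has_deriv_right_zero hgc.continuousOn (fun s _ => hgd s) b ⟨hab, le_rfl⟩
  have hg0 : g 0 = 0 := by simp [hg, hy]
  have hgz : ∀ t, g t = 0 := fun t => by
    rcases le_total 0 t with ht | ht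
    · rw [hconst 0 t ht, hg0]
    · rw [← hconst t 0 ht, hg0]
  have hyz : ∀ t, y t = 0 := fun t => by
    have h1 : T t (g t) = y t := by
      simp only [hg]
      rw [← hT.apply_add, add_neg_cancel, hT.apply_zero]
    rw [← h1, hgz, _root_.map_zero]
  ext t
  have := h t
  rw [show (∫ s in (0 : ℝ)..t, w s) = 0 from hyz t] at this
  exact tendsto_nhds_unique this (isGeneratorValue_zero T)

theorem eq_of_isMildSolution (hT : IsC0Group T) {u v : ℝ → X}
    (hu : IsMildSolution (generator T) φ u) (hv : IsMildSolution (generator T) φ v)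
    (h0 : u 0 = v 0) : u = v := by
  refine sub_eq_zero.1 (hT.eq_zero_of_isMildSolution_zero (w := u - v) (hu.1.sub hv.1) fun t => ?_)
  obtain ⟨h1, e1⟩ := hu.2 t
  obtain ⟨h2, e2⟩ := hv.2 t
  have h3 := (generator_spec T ⟨_, h1⟩).add ((generator_spec T ⟨_, h2⟩).smul (-1))
  simp only [neg_smul, one_smul, ← sub_eq_add_neg] at h3
  rw [← intervalIntegral.integral_sub (hu.1.intervalIntegrable _ _)
    (hv.1.intervalIntegrable _ _)] at h3
  have e : (u - v) t = generator T ⟨_, h1⟩ - generator T ⟨_, h2⟩ := by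
    rw [Pi.sub_apply, e1, e2, h0]
    abel
  rw [e]
  exact h3

end IsC0Group

/-! ### Boundedness and uniform continuity for bounded groups -/

namespace IsC0Group

/-- Apply T(t-r) to the identity `hV` at time r and integrate over r from 0 to t. -/
theorem integral_smul_integral_eq_zero (hT : IsC0Group T) {M : ℝ} (hM : ∀ t, ‖T t‖ ≤ M)
    (hφ : StronglyMeasurable φ) {K : ℝ} (hK : ∀ t, ‖φ t‖ ≤ K) {V : 𝓢(ℝ, ℂ)}
    (hV : ∀ t, ∫ s, V s • T s (φ (t - s)) = 0) (t : ℝ) :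
    ∫ s, V s • ∫ r in (-s)..(t - s), T (t - r) (φ r) = 0 := by
  have hM0 : 0 ≤ M := (norm_nonneg _).trans (hM 0)
  have hint : Integrable (fun q : ℝ × ℝ => V q.2 • T (t - (q.1 - q.2)) (φ (q.1 - q.2)))
      ((volume.restrict (Set.uIoc 0 t)).prod volume) := by
    have : IsFiniteMeasure (volume.restrict (Set.uIoc 0 t)) := ⟨by simp [Set.uIoc]⟩
    have h1 : Integrable (fun q : ℝ × ℝ => V q.2) ((volume.restrict (Set.uIoc 0 t)).prod volume) :=
      (V.integrable (μ := volume)).comp_snd _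
    refine Integrable.smul_of_top_left (φ := fun q : ℝ × ℝ => V q.2) h1
      (memLp_top_of_bound ?_ (M * K) (.of_forall fun q => ?_))
    · exact (hT.stronglyMeasurable_apply (f := fun q : ℝ × ℝ => t - (q.1 - q.2)) (by fun_prop)
        (hφ.comp_measurable (measurable_fst.sub measurable_snd))).aestronglyMeasurable
    · exact (norm_orbit_le hM _ _).trans (mul_le_mul_of_nonneg_left (hK _) hM0)
  calc _ = ∫ s, ∫ r in (0 : ℝ)..t, V s • T (t - (r - s)) (φ (r - s)) := by
        congr with s
        rw [intervalIntegral.integral_smul,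
          intervalIntegral.integral_comp_sub_right (fun r => T (t - r) (φ r)), zero_sub]
    _ = ∫ r in (0 : ℝ)..t, ∫ s, V s • T (t - (r - s)) (φ (r - s)) :=
        (intervalIntegral_integral_swap hint).symm
    _ = ∫ r in (0 : ℝ)..t, (0 : X) := by
        congr with r
        rw [← _root_.map_zero (T (t - r)), ← hV r, ← ContinuousLinearMap.integral_comp_comm]
        · congr with s
          rw [map_smul, ← hT.apply_add, sub_add]
        · exact integrable_smul_bdd V.integrable (hT.stronglyMeasurable_apply measurable_id
            (hφ.comp_measurable (measurable_const.sub measurable_id)))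
            fun s => (norm_orbit_le hM _ _).trans (mul_le_mul_of_nonneg_left (hK (r - s)) hM0)
    _ = 0 := by simp

/-- As ∫ V = 1, the Duhamel term is the V-average of its difference from the integral over the
interval from -s to t-s. That difference consists of two end pieces of length |s|, which gives a
bound free of t. -/
theorem norm_duhamel_le (hT : IsC0Group T) {M : ℝ} (hM : ∀ t, ‖T t‖ ≤ M)
    (hφ : StronglyMeasurable φ) {K : ℝ} (hK : ∀ t, ‖φ t‖ ≤ K) {V : 𝓢(ℝ, ℂ)}
    (hV1 : ∫ s, V s = 1) (hV : ∀ t, ∫ s, V s • T s (φ (t - s)) = 0) (t : ℝ) :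
    ‖duhamel T φ t‖ ≤ ∫ s, ‖V s‖ * (2 * (M * K) * |s|) := by
  have hM0 : 0 ≤ M := (norm_nonneg _).trans (hM 0)
  have hii := hT.intervalIntegrable_apply hφ hK t
  have hbound : ∀ a b, ‖∫ r in a..b, T (t - r) (φ r)‖ ≤ M * K * |b - a| := fun a b =>
    intervalIntegral.norm_integral_le_of_norm_le_const fun r _ =>
      (norm_orbit_le hM _ _).trans (mul_le_mul_of_nonneg_left (hK _) hM0)
  set F : ℝ → X := fun r => ∫ σ in (0 : ℝ)..r, T (t - σ) (φ σ) with hF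
  have hFc : Continuous F := intervalIntegral.continuous_primitive hii 0
  have hI : ∀ s, ∫ r in (-s)..(t - s), T (t - r) (φ r) = F (t - s) - F (-s) := fun s =>
    (intervalIntegral.integral_interval_sub_left (hii _ _) (hii _ _)).symm
  have h0 := hT.integral_smul_integral_eq_zero hM hφ hK hV t
  have hint : Integrable fun s => V s • ∫ r in (-s)..(t - s), T (t - r) (φ r) := by
    refine integrable_smul_bdd V.integrable (C := M * K * |t|) ?_ fun s => ?_
    · simp only [hI]
      exact Continuous.stronglyMeasurable (by fun_prop)
    · refine (hbound _ _).trans (le_of_eq ?_)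
      congr 2
      ring
  have e : duhamel T φ t =
      ∫ s, V s • (duhamel T φ t - ∫ r in (-s)..(t - s), T (t - r) (φ r)) := by
    simp only [smul_sub]
    rw [integral_sub (V.integrable.smul_const _) hint, h0, integral_smul_const, hV1, one_smul,
      sub_zero]
  rw [e]
  refine norm_integral_le_of_norm_le ?_ (.of_forall fun s => ?_)
  · have := (V.integrable_pow_mul volume 1).const_mul (2 * (M * K))
    refine this.congr (.of_forall fun s => ?_)
    simp only [pow_one, Real.norm_eq_abs]
    ring
  · rw [norm_smul]
    refine mul_le_mul_of_nonneg_left ?_ (norm_nonneg _)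
    have h2 : duhamel T φ t - ∫ r in (-s)..(t - s), T (t - r) (φ r) =
        (∫ r in (t - s)..t, T (t - r) (φ r)) + ∫ r in (0 : ℝ)..(-s), T (t - r) (φ r) := by
      rw [hI, ← intervalIntegral.integral_interval_sub_left (hii 0 t) (hii 0 (t - s)), duhamel, hF]
      abel
    rw [h2]
    refine (norm_add_le _ _).trans ((add_le_add (hbound _ _) (hbound _ _)).trans (le_of_eq ?_))
    rw [sub_sub_cancel, sub_zero, abs_neg]
    ring

/-- Writing x as the h-average of its orbit moves the time shift onto h, which is Lipschitz under
translation in L¹. -/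
theorem exists_norm_sub_le (hT : IsC0Group T) {M : ℝ} (hM : ∀ t, ‖T t‖ ≤ M) {h : 𝓢(ℝ, ℂ)}
    (hh : ∀ x, cv h (fun t => T t x) 0 = x) :
    ∃ C, 0 ≤ C ∧ ∀ r x, ‖T r x - x‖ ≤ C * |r| * ‖x‖ := by
  obtain ⟨C, hC0, hC⟩ := exists_integral_norm_translate_sub_le h
  have hM0 : 0 ≤ M := (norm_nonneg _).trans (hM 0)
  refine ⟨C * M, by positivity, fun r x => ?_⟩
  have hint := fun {f : ℝ → ℂ} (hf : Integrable f) => integrable_cv hf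
      (hT.stronglyMeasurable_orbit x) (norm_orbit_le hM x) 0
  have e : T r x - x = cv (fun s => h (s - -r) - h s) (fun t => T t x) 0 := by
    have h1 : cv h (fun t => T t x) r = T r x := by
      rw [hT.cv_orbit hM h.integrable, hh]
    have h2 : T r x - x = cv h (fun t => T t x) r - cv h (fun t => T t x) 0 := by rw [h1, hh]
    rw [h2, cv, cv, cv, ← integral_sub_right_eq_self _ (-r), ← integral_sub]
    · congr with s
      rw [sub_smul]
      congr 4
      ring
    · refine (hint (h.integrable.comp_sub_right (-r))).congr (.of_forall fun s => ?_)
      simp only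
      congr 3
      ring
    · exact hint h.integrable
  rw [e]
  refine (norm_cv_le ((h.integrable.comp_sub_right (-r)).sub h.integrable)
    (norm_orbit_le hM x) 0).trans ?_
  have := hC (-r)
  rw [abs_neg] at this
  simp only [Pi.sub_apply]
  calc _ ≤ C * |r| * (M * ‖x‖) := by gcongr
    _ = _ := by ring

omit [CompleteSpace X] in
theorem isBUC_of_isEvolution {M : ℝ} (hM : ∀ t, ‖T t‖ ≤ M) {K : ℝ} (hK : ∀ t, ‖φ t‖ ≤ K)
    {C : ℝ} (hC0 : 0 ≤ C) (hC : ∀ r x, ‖T r x - x‖ ≤ C * |r| * ‖x‖) {u : ℝ → X} {B : ℝ}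
    (hB : ∀ t, ‖u t‖ ≤ B) (hu : IsEvolution T φ u) : IsBUC u := by
  have hM0 : 0 ≤ M := (norm_nonneg _).trans (hM 0)
  have hK0 : 0 ≤ K := (norm_nonneg _).trans (hK 0)
  have hB0 : 0 ≤ B := (norm_nonneg _).trans (hB 0)
  refine ⟨isBounded_iff_forall_norm_le.2 ⟨B, by rintro _ ⟨t, rfl⟩; exact hB t⟩, ?_⟩
  refine (LipschitzWith.of_dist_le_mul (K := ⟨C * B + M * K, by positivity⟩)
    fun s t => ?_).uniformContinuous
  have h1 := hu t (s - t)
  rw [add_sub_cancel] at h1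
  rw [dist_eq_norm, h1, Real.dist_eq, add_sub_right_comm]
  have h2 : ‖∫ q in (0 : ℝ)..(s - t), T (s - t - q) (φ (t + q))‖ ≤ M * K * |s - t - 0| :=
    intervalIntegral.norm_integral_le_of_norm_le_const fun r _ =>
      (norm_orbit_le hM _ _).trans (mul_le_mul_of_nonneg_left (hK _) hM0)
  rw [sub_zero] at h2
  refine (norm_add_le _ _).trans ((add_le_add (hC _ _) h2).trans ?_)
  have h3 : C * |s - t| * ‖u t‖ ≤ C * |s - t| * B := by gcongr; exact hB t
  show _ ≤ (C * B + M * K) * |s - t|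
  linarith

/-- For a bounded group, the spectral separation of `φ` from `σ(A)` makes the variation of constants
solutions bounded and uniformly continuous. Of the resolvent only the boundedness of `σ(A) ∩ iℝ`
is used: for a bounded group it makes `t ↦ T t` Lipschitz in operator norm. -/
theorem isBUC_duhamel (hT : IsC0Group T) (hφ : StronglyMeasurable φ) {K : ℝ}
    (hK : ∀ t, ‖φ t‖ ≤ K) {M : ℝ} (hM : ∀ t, ‖T t‖ ≤ M) {a : ℝ}
    (hσ : ∀ t : ℝ, Complex.I * t ∈ spectrumOf (generator T) → t ∈ Set.Ioo (-a) a)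
    (hsp : ∀ w ∈ beurlingSpectrum φ, Complex.I * w ∉ spectrumOf (generator T)) (x : X) :
    IsBUC fun t => T t x + duhamel T φ t := by
  set Λ := (regularSet (hT.annihilator M hM))ᶜ with hΛ
  set S := (regularSet (EvolEq.annihilator φ hφ K hK))ᶜ with hS
  have hΛσ : ∀ w ∈ Λ, Complex.I * ↑(2 * Real.pi * w) ∈ spectrumOf (generator T) := fun w hw => by
    by_contra h
    exact hw (hT.mem_regularSet_annihilator M hM h)
  -- The frequency w stands for the spectral point 2πiw, so |w| < a/(2π) in fact holds; the radius a
  -- is enough.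
  have hΛb : Λ ⊆ Metric.ball 0 a := fun w hw => by
    have h1 := abs_lt.2 (hσ _ (hΛσ w hw))
    rw [abs_mul, abs_of_pos Real.two_pi_pos] at h1
    rw [Metric.mem_ball, Real.dist_eq, sub_zero]
    nlinarith [abs_nonneg w, Real.pi_gt_three]
  have hΛc : IsCompact Λ := Metric.isCompact_of_isClosed_isBounded
    (isOpen_regularSet _).isClosed_compl (Metric.isBounded_ball.subset hΛb)
  have hdisj : Disjoint Λ S := Set.disjoint_left.2 fun w hw hwS => by
    by_cases hwb : 2 * Real.pi * w ∈ beurlingSpectrum φ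
    · exact hsp _ hwb (hΛσ w hw)
    · exact hwS (EvolEq.mem_regularSet_annihilator φ hφ K hK hwb)
  obtain ⟨h, δ, hδ, hc, h1, h2⟩ := exists_fourier_eq_one_nhdsSet hΛc
    (isOpen_regularSet _).isClosed_compl hdisj
  have hh := hT.cv_eq_self hM hΛb hc h1
  have hV0 := integral_mul_translate_smul_eq_zero hφ hK hδ hc
    fun ξ hξ η hη => Set.notMem_compl_iff.1 (h2 ξ hξ η hη)
  have hV := hT.integral_smul_translate_eq_zero hM hφ hK hh hV0
  have hv := hT.norm_duhamel_le hM hφ hK (integral_fourierInv_cutoff_zero _) hV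
  obtain ⟨C, hC0, hC⟩ := hT.exists_norm_sub_le hM hh
  exact isBUC_of_isEvolution hM hK hC0 hC
    (fun t => (norm_add_le _ _).trans (add_le_add (norm_orbit_le hM x t) (hv t)))
    (hT.isEvolution_duhamel hφ hK x)

end IsC0Group

/-! ### Passage to a bounded representative -/

theorem exists_stronglyMeasurable_bounded_ae_eq {Y : Type*} [NormedAddCommGroup Y] {φ : ℝ → Y}
    (hφ : MemLp φ ⊤ (volume : Measure ℝ)) :
    ∃ ψ : ℝ → Y, StronglyMeasurable ψ ∧ (∃ K, ∀ t, ‖ψ t‖ ≤ K) ∧ φ =ᵐ[volume] ψ := by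
  set ψ := hφ.1.mk φ with hψ
  have hψm : StronglyMeasurable ψ := hφ.1.stronglyMeasurable_mk
  set K := lpNorm φ ⊤ volume with hKdef
  have hK : ∀ᵐ t, ‖φ t‖ ≤ K := ae_le_lpNorm_exponent_top hφ
  have hK0 : 0 ≤ K := lpNorm_nonneg
  have hs : MeasurableSet {t | ‖ψ t‖ ≤ K} := hψm.norm.measurable measurableSet_Iic
  refine ⟨{t | ‖ψ t‖ ≤ K}.indicator ψ, hψm.indicator hs, ⟨K, fun t => ?_⟩, ?_⟩
  · by_cases ht : t ∈ {t | ‖ψ t‖ ≤ K}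
    · rw [Set.indicator_of_mem ht]
      exact ht
    · rw [Set.indicator_of_notMem ht, norm_zero]
      exact hK0
  · filter_upwards [hφ.1.ae_eq_mk, hK] with t ht hKt
    rw [Set.indicator_of_mem, ht]
    show ‖ψ t‖ ≤ K
    rwa [hψ, ← ht]

omit [CompleteSpace X] in
theorem beurlingSpectrum_congr_ae {φ ψ : ℝ → X} (h : φ =ᵐ[volume] ψ) :
    beurlingSpectrum φ = beurlingSpectrum ψ := by
  have e : ∀ (f : ℝ → ℂ) (t : ℝ), ∫ s, f s • φ (t - s) = ∫ s, f s • ψ (t - s) := fun f t => by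
    refine integral_congr_ae ?_
    filter_upwards [(quasiMeasurePreserving_sub_left volume t).ae_eq_comp h] with s hs
    simp only [Function.comp] at hs
    rw [hs]
  simp only [beurlingSpectrum, e]

omit [CompleteSpace X] in
theorem IsMildSolution.congr_ae {A : X →ₗ.[ℂ] X} {φ ψ u : ℝ → X} (h : φ =ᵐ[volume] ψ)
    (hu : IsMildSolution A φ u) : IsMildSolution A ψ u := by
  refine ⟨hu.1, fun t => ?_⟩
  obtain ⟨hd, he⟩ := hu.2 t
  refine ⟨hd, ?_⟩
  rw [← intervalIntegral.integral_congr_ae (h.mono fun s hs _ => hs)]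
  exact he

end EvolEq
end

theorem corollary5p7 {X : Type*} [NormedAddCommGroup X] [NormedSpace ℂ X] [CompleteSpace X]
    (T : ℝ → X →L[ℂ] X) (hT : EvolEq.IsC0Group T)
    (a : ℝ) (ha : 0 < a)
    (hK : ∀ t : ℝ, Complex.I * t ∈ EvolEq.spectrumOf (EvolEq.generator T) → t ∈ Set.Ioo (-a) a)
    (θ : ℝ) (hθ : 1 / 2 < θ)
    (hR : ∃ C : ℝ, ∀ t : ℝ, t ∉ Set.Ioo (-a) a →
      |t| ^ θ * ‖EvolEq.resolventOf (EvolEq.generator T) (Complex.I * t)‖ ≤ C)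
    (φ : ℝ → X) (hφ : MemLp φ ⊤ (volume : Measure ℝ))
    (hsp : ∀ w ∈ EvolEq.beurlingSpectrum φ,
      Complex.I * w ∉ EvolEq.spectrumOf (EvolEq.generator T)) :
    (∀ x : X, ∃! u : ℝ → X,
      EvolEq.IsMildSolution (EvolEq.generator T) φ u ∧ u 0 = x) ∧
    (BddAbove (Set.range fun t : ℝ => ‖T t‖) →
      ∀ (x : X) (u : ℝ → X),
        EvolEq.IsMildSolution (EvolEq.generator T) φ u → u 0 = x → EvolEq.IsBUC u) := by
  -- Neither mild solutions nor the Beurling spectrum depend on null sets, so an everywhere bounded,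
  -- strongly measurable representative may replace φ.
  obtain ⟨ψ, hψ, ⟨K, hψK⟩, hφψ⟩ := EvolEq.exists_stronglyMeasurable_bounded_ae_eq hφ
  have hmild : ∀ x, EvolEq.IsMildSolution (EvolEq.generator T) φ
      fun t => T t x + EvolEq.duhamel T ψ t := fun x =>
    (hT.isMildSolution_of_isEvolution hψ hψK
      ((hT.continuous_orbit x).add (hT.continuous_duhamel hψ hψK))
      (hT.isEvolution_duhamel hψ hψK x)).congr_ae hφψ.symm
  have h0 : ∀ x, T 0 x + EvolEq.duhamel T ψ 0 = x := fun x => by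
    rw [hT.apply_zero, EvolEq.duhamel, intervalIntegral.integral_same, add_zero]
  refine ⟨fun x => ⟨_, ⟨hmild x, h0 x⟩, fun u hu => ?_⟩, fun ⟨M, hM⟩ x u hu hux => ?_⟩
  · exact hT.eq_of_isMildSolution hu.1 (hmild x) (hu.2.trans (h0 x).symm)
  · rw [hT.eq_of_isMildSolution hu (hmild x) (hux.trans (h0 x).symm)]
    rw [EvolEq.beurlingSpectrum_congr_ae hφψ] at hsp
    exact hT.isBUC_duhamel hψ hψK (fun t => hM ⟨t, rfl⟩) hK hsp x
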